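/- Let $\Phi$ be a commutative unital ring in which $2$ and $3$ are invertible, and let $A$ be a semiprime, non-commutative, associative (not necessarily unital) $\Phi$-algebra with a $\Phi$-linear involution $*$. Let $Z(A)$ be the center of $A$, let $K=\{x\in A : x^*=-x\}$ be the Lie algebra of skew elements (with bracket $[x,y]=xy-yx$), let $Z(K)$ be the center of the Lie algebra $K$, and let $\mathrm{Inn}(K)=\{[k,\cdot\,]:K\to K \mid k\in K\}$ be the Lie algebra of inner derivations of $K$. Let $\mathrm{SDer}(A)$ be the Lie algebra of all $\Phi$-linear associative derivations $\delta$ of $A$ with $\delta(x^*)=\delta(x)^*$ for all $x\in A$; for $k\in K$ let $\mathrm{ad}\,k\in \mathrm{SDer}(A)$ be the derivation $x\mapsto kx-xk$ of $A$; and put $I_{K,Z}=\{\delta\in\mathrm{SDer}(A) : \delta(K)\subseteq Z(A)\}$, a Lie ideal of $\mathrm{SDer}(A)$. For a semiprime ring $R$ with extended centroid $\mathcal C$ (the center of its two-sided right ring of quotients; its elements are represented by $R$-bimodule homomorphisms $J\to R$ defined on two-sided ideals $J$ of $R$ with zero left annihilator), let $\deg(R)$ be the supremum over $x\in R$ of the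 least degree of a monic polynomial over $\mathcal C$ that vanishes at $x$ ($\infty$ if there is none). A $*$-ideal is a two-sided ideal $I$ with $I^*=I$; a non-zero algebra with involution is $*$-prime if the product of any two non-zero $*$-ideals is non-zero; a $*$-ideal $P$ of $A$ is $*$-prime if $A/P$ is a (non-zero) $*$-prime algebra. Consider the condition $$(\mathrm{D})\qquad \deg(A/P)>2 \quad\text{for every $*$-prime ideal $P$ of $A$.}$$ Then: (i) The rule $[k,\cdot\,]\mapsto \overline{\mathrm{ad}\,k}$ $(k\in K)$ is a well-defined injective homomorphism of Lie algebras $\mathrm{Inn}(K)\to \mathrm{SDer}(A)/I_{K,Z}$, and its image is an ideal of $\mathrm{SDer}(A)/I_{K,Z}$. If (D) holds, this ideal is essential, that is, it meets every non-zero ideal non-trivially; moreover $\mathrm{ad}\,k\in I_{K,Z}$ then implies $\mathrm{ad}\,k=0$, so that also $\mathrm{ad}(K)\subseteq\mathrm{SDer}(A)$ embeds in $\mathrm{SDer}(A)/I_{K,Z}$, with the same image. (ii) Assume (D). If $Z(K)$ contains no non-zero $*$-ideal of $A$, then $I_{K,Z}=0$. In particular, if $A$ is $*$-prime, then $Z(K)$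 contains no non-zero $*$-ideal of $A$, and $I_{K,Z}=0$. -/

import Mathlib

/-! Lie structure of a (not necessarily unital) associative algebra. -/

/-- `A⁻`: the associative, not necessarily unital ring `A` with the commutator bracket
`⁅x, y⁆ = x * y - y * x`. -/
@[reducible]
def StarDer.commutatorLieRing (A : Type*) [NonUnitalRing A] : LieRing A where
  bracket x y := x * y - y * x
  add_lie _ _ _ := by simp only [right_distrib, left_distrib]; abel
  lie_add _ _ _ := by simp only [right_distrib, left_distrib]; abel
  lie_self := by simp only [forall_const, sub_self]
  leibniz_lie _ _ _ := by
    simp only [mul_sub_left_distrib, mul_sub_right_distrib, mul_assoc]; abel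

attribute [local instance 50] StarDer.commutatorLieRing
attribute [local instance 100] LieRing.ofAssociativeRing

namespace StarDer

/-- `A⁻` is a Lie algebra over `Φ`. -/
instance (priority := 50) commutatorLieAlgebra (Φ A : Type*) [CommRing Φ] [NonUnitalRing A]
    [Module Φ A] [IsScalarTower Φ A A] [SMulCommClass Φ A A] : LieAlgebra Φ A where
  lie_smul t x y := by
    change x * (t • y) - (t • y) * x = t • (x * y - y * x)
    rw [mul_smul_comm, smul_mul_assoc, smul_sub]

section Ideals

variable {A : Type*} [NonUnitalRing A]

/-- `A` is semiprime: it has no non-zero two-sided ideal of square zero. -/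
def IsSemiprimeRing (A : Type*) [NonUnitalRing A] : Prop :=
  ∀ I : TwoSidedIdeal A, (∀ x ∈ I, ∀ y ∈ I, x * y = 0) → I = ⊥

/-- A `*`-ideal: a two-sided ideal invariant under the involution. -/
def IsStarIdeal [StarRing A] (I : TwoSidedIdeal A) : Prop :=
  ∀ x ∈ I, star x ∈ I

/-- `A` is `*`-prime: it is non-zero and the product of two non-zero `*`-ideals is non-zero. -/
def IsStarPrime (A : Type*) [NonUnitalRing A] [StarRing A] : Prop :=
  Nontrivial A ∧ ∀ I J : TwoSidedIdeal A, IsStarIdeal I → IsStarIdeal J →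
    (∀ x ∈ I, ∀ y ∈ J, x * y = 0) → I = ⊥ ∨ J = ⊥

/-- `P` is a `*`-prime ideal: a proper `*`-ideal such that `A / P` is `*`-prime, i.e.
`I J ⊆ P` implies `I ⊆ P` or `J ⊆ P` for all `*`-ideals `I`, `J` of `A`. -/
def IsStarPrimeIdeal [StarRing A] (P : TwoSidedIdeal A) : Prop :=
  IsStarIdeal P ∧ P ≠ ⊤ ∧ ∀ I J : TwoSidedIdeal A, IsStarIdeal I → IsStarIdeal J →
    (∀ x ∈ I, ∀ y ∈ J, x * y ∈ P) → I ≤ P ∨ J ≤ P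

end Ideals

section Degree

/-- A dense two-sided ideal: one with zero left annihilator. (In a semiprime ring, left and right
annihilators of two-sided ideals coincide, and dense is the same as essential.) -/
def IsDenseIdeal {R : Type*} [NonUnitalRing R] (I : TwoSidedIdeal R) : Prop :=
  ∀ a : R, (∀ y ∈ I, a * y = 0) → a = 0

/-- A representative of an element of the extended centroid `C(R)` of a semiprime ring `R`:
a homomorphism of `R`-bimodules `dom → R` defined on a dense two-sided ideal `dom`
(the values of `toFun` outside `dom` are irrelevant). As an element of the centre of the two-sided
right ring of quotients of `R`, it is the element `c` with `c * y = toFun y` for `y ∈ dom`;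
two representatives define the same element when they agree on some dense ideal. -/
structure PartialCentralizer (R : Type*) [NonUnitalRing R] where
  /-- the domain of definition -/
  dom : TwoSidedIdeal R
  dense : IsDenseIdeal dom
  /-- the action on the domain -/
  toFun : R → R
  map_add : ∀ y ∈ dom, ∀ z ∈ dom, toFun (y + z) = toFun y + toFun z
  map_mul_left : ∀ r : R, ∀ y ∈ dom, toFun (r * y) = r * toFun y
  map_mul_right : ∀ r : R, ∀ y ∈ dom, toFun (y * r) = toFun y * r

/-- `x` is a root of a monic polynomial of degree `n` over the extended centroid:
`x ^ n + c (n - 1) * x ^ (n - 1) + ⋯ + c 0 = 0` in the ring of quotients of `R`. An element of that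
ring is zero iff its left multiplication kills a dense ideal `J`; on `y ∈ J`, the term
`c i * x ^ i` acts as `y ↦ c i (x ^ i * y)`. -/
def IsAlgebraicOfDegree {R : Type*} [NonUnitalRing R] (x : R) (n : ℕ) : Prop :=
  ∃ (c : Fin n → PartialCentralizer R) (J : TwoSidedIdeal R), IsDenseIdeal J ∧
    (∀ i, J ≤ (c i).dom) ∧
    ∀ y ∈ J, (fun z => x * z)^[n] y
      + ∑ i : Fin n, (c i).toFun ((fun z => x * z)^[(i : ℕ)] y) = 0

/-- `deg x`: the degree of algebraicity of `x` over the extended centroid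
(`⊤` when `x` is not algebraic). -/
noncomputable def elementDegree {R : Type*} [NonUnitalRing R] (x : R) : ℕ∞ :=
  ⨅ (n : ℕ) (_ : IsAlgebraicOfDegree x n), (n : ℕ∞)

/-- `deg R = sup {deg x | x ∈ R}`. -/
noncomputable def ringDegree (R : Type*) [NonUnitalRing R] : ℕ∞ :=
  ⨆ x : R, elementDegree x

/-- The restriction ruling out low degrees: `deg (A / P) > 2` for every `*`-prime ideal `P`. -/
def StarPrimeQuotientsDegreeGTTwo (A : Type*) [NonUnitalRing A] [StarRing A] : Prop :=
  ∀ P : TwoSidedIdeal A, IsStarPrimeIdeal P → 2 < ringDegree P.ringCon.Quotient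

end Degree

section Derivations

variable (Φ A : Type*) [CommRing Φ] [NonUnitalRing A] [Module Φ A] [IsScalarTower Φ A A]
  [SMulCommClass Φ A A]

/-- `Der(A)`: the Lie algebra of all (`Φ`-linear) associative derivations of `A`. -/
def Der : LieSubalgebra Φ (Module.End Φ A) where
  carrier := {δ | ∀ x y : A, δ (x * y) = δ x * y + x * δ y}
  zero_mem' := by intro x y; simp
  add_mem' := by
    intro a b ha hb x y
    simp only [LinearMap.add_apply, ha x y, hb x y, add_mul, mul_add]; abel
  smul_mem' := by
    intro c a ha x y
    simp only [LinearMap.smul_apply, ha x y, smul_add, smul_mul_assoc, mul_smul_comm]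
  lie_mem' := by
    intro a b ha hb x y
    simp only [LieRing.of_associative_ring_bracket, LinearMap.sub_apply, Module.End.mul_apply,
      ha _ _, hb _ _, _root_.map_add, sub_mul, mul_sub]
    abel

variable [Star Φ] [TrivialStar Φ] [StarRing A] [StarModule Φ A]

/-- `K`: the Lie subalgebra of `A⁻` of skew elements, `x* = -x`. -/
def skew : LieSubalgebra Φ A where
  carrier := {x | star x = -x}
  zero_mem' := by simp
  add_mem' := by
    intro a b ha hb
    simp only [Set.mem_ofPred_eq] at *
    rw [star_add, ha, hb, neg_add]
  smul_mem' := by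
    intro c a ha
    simp only [Set.mem_ofPred_eq] at *
    rw [star_smul, ha, star_trivial, smul_neg]
  lie_mem' := by
    intro a b ha hb
    simp only [Set.mem_ofPred_eq] at *
    change star (a * b - b * a) = -(a * b - b * a)
    rw [star_sub, star_mul, star_mul, ha, hb]; simp

/-- `SDer(A)`: the Lie algebra of derivations of `A` that commute with the involution. -/
def SDer : LieSubalgebra Φ (Module.End Φ A) where
  carrier := {δ | δ ∈ Der Φ A ∧ ∀ x : A, δ (star x) = star (δ x)}
  zero_mem' := ⟨(Der Φ A).zero_mem, by simp⟩
  add_mem' := by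
    rintro a b ⟨ha, ha'⟩ ⟨hb, hb'⟩
    exact ⟨(Der Φ A).add_mem ha hb, fun x => by simp [ha', hb']⟩
  smul_mem' := by
    rintro c a ⟨ha, ha'⟩
    exact ⟨(Der Φ A).smul_mem c ha, fun x => by simp [ha']⟩
  lie_mem' := by
    rintro a b ⟨ha, ha'⟩ ⟨hb, hb'⟩
    refine ⟨(Der Φ A).lie_mem ha hb, fun x => ?_⟩
    simp [LieRing.of_associative_ring_bracket, ha', hb']

/-- `I_{K,Z}`: the Lie ideal of `SDer(A)` of those `δ` with `δ(K) ⊆ Z(A)`. -/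
def IKZ : LieIdeal Φ (SDer Φ A) where
  carrier := {δ | ∀ k ∈ skew Φ A, δ.1 k ∈ NonUnitalSubring.center A}
  zero_mem' := by intro k _; exact (NonUnitalSubring.center A).zero_mem
  add_mem' := by
    intro a b ha hb k hk
    exact (NonUnitalSubring.center A).add_mem (ha k hk) (hb k hk)
  smul_mem' := by
    intro c a ha k hk
    have := ha k hk
    rw [NonUnitalSubring.mem_center_iff] at this ⊢
    intro g
    change g * (c • a.1 k) = (c • a.1 k) * g
    rw [mul_smul_comm, smul_mul_assoc, this g]
  lie_mem := by
    rintro ⟨d, hd, hd'⟩ ⟨m, hm, hm'⟩ h k hk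
    have h' : ∀ k ∈ skew Φ A, m k ∈ NonUnitalSubring.center A := h
    have hdk : d k ∈ skew Φ A := by
      have hk' : star k = -k := hk
      change star (d k) = -(d k)
      rw [← hd', hk', map_neg]
    have hz : d (m k) ∈ NonUnitalSubring.center A := by
      have hmk := h' k hk
      rw [NonUnitalSubring.mem_center_iff] at hmk ⊢
      intro g
      have e := congrArg d (hmk g)
      rw [hd, hd, hmk (d g)] at e
      rwa [add_comm, add_right_cancel_iff] at e
    exact (NonUnitalSubring.center A).sub_mem hz (h' _ hdk)

/-- The Lie homomorphism `ad : K → SDer(A)`, `ad k (x) = k x - x k`; its range is `ad(K)`. -/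
def adSkew : skew Φ A →ₗ⁅Φ⁆ SDer Φ A where
  toFun k :=
    ⟨{ toFun := fun x => k.1 * x - x * k.1
       map_add' := fun x y => by rw [mul_add, add_mul]; abel
       map_smul' := fun c x => by simp [mul_smul_comm, smul_mul_assoc, smul_sub] },
     fun x y => by
      simp only [LinearMap.coe_mk, AddHom.coe_mk, sub_mul, mul_sub, mul_assoc]; abel,
     fun x => by
      have hk : star k.1 = -k.1 := k.2
      simp only [LinearMap.coe_mk, AddHom.coe_mk, star_sub, star_mul, hk]
      rw [mul_neg, neg_mul]; abel⟩
  map_add' k l := by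
    apply Subtype.ext; ext x
    change (k.1 + l.1) * x - x * (k.1 + l.1) = (k.1 * x - x * k.1) + (l.1 * x - x * l.1)
    rw [mul_add, add_mul]; abel
  map_smul' c k := by
    apply Subtype.ext; ext x
    change (c • k.1) * x - x * (c • k.1) = c • (k.1 * x - x * k.1)
    rw [mul_smul_comm, smul_mul_assoc, smul_sub]
  map_lie' := by
    intro k l
    apply Subtype.ext; ext x
    change (k.1 * l.1 - l.1 * k.1) * x - x * (k.1 * l.1 - l.1 * k.1) =
      (k.1 * (l.1 * x - x * l.1) - (l.1 * x - x * l.1) * k.1)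
        - (l.1 * (k.1 * x - x * k.1) - (k.1 * x - x * k.1) * l.1)
    simp only [sub_mul, mul_sub, mul_assoc]; abel

/-- `Inn(K)`: the Lie algebra of inner derivations `⁅k, ·⁆ : K → K` of the Lie algebra `K`. -/
abbrev InnK : LieSubalgebra Φ (Module.End Φ (skew Φ A)) :=
  (LieAlgebra.ad Φ (skew Φ A)).range

/-- `Z(K)`, the centre of the Lie algebra `K`, as a subset of `A`. -/
def centerK : Set A :=
  Subtype.val '' (LieAlgebra.center Φ (skew Φ A) : Set (skew Φ A))

/-- `Z(K)` contains no non-zero (associative) `*`-ideal of `A`. -/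
def CenterKHasNoStarIdeal : Prop :=
  ∀ I : TwoSidedIdeal A, IsStarIdeal I → (∀ x ∈ I, x ∈ centerK Φ A) → I = ⊥

end Derivations

/-- A Lie ideal is essential if it meets every non-zero Lie ideal non-trivially. -/
def IsEssentialIdeal {Φ L : Type*} [CommRing Φ] [LieRing L] [LieAlgebra Φ L]
    (J : LieIdeal Φ L) : Prop :=
  ∀ I : LieIdeal Φ L, I ≠ ⊥ → J ⊓ I ≠ ⊥

end StarDer

/-! Everything that depends on (D) follows from one fact, `IKZ_eq_bot`: under (D), `I_{K,Z} = 0`.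
Let `δ(K) ⊆ Z(A)`. For skew `x` the cube `x³` is skew and `δ(x³) = 3 δ(x) x²`, so `δ(x) x²` is
central. Polarizing this cubic relation and eliminating terms shows, with `z = δ(x)`, that `z³ (y v
+ v y)` is central for all skew `y`, `v`. If `z ≠ 0`, some `*`-prime ideal `P` misses `z`. In `A /
P` the class of `z` is central, skew and non-zero, hence cancellable, so anticommutators of skew
elements are central there. By `ringDegree_le_two_of_skew` this forces degree at most 2, against
(D). Hence `δ(K) = 0`. For symmetric `h`, applying `δ` to the skew element `h x + x h` shows that
`δ(h)` anticommutes with `K`; by `skew_anticommutator_mem_center`, if it were non-zero, some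
quotient `A / P` would again have degree at most 2.

Injectivity on `Inn(K)` does not use (D): if `z = [k, x]` and `z x²` are central, commuting with `k`
gives `2 z² x = 0`, then `z³ = 0`, so `z = 0` by semiprimeness. The image is an ideal because `[δ,
ad k] = ad (δ k)`. The same identity gives essentiality: an ideal meeting the image trivially
consists of classes of `δ` with `ad (δ k) = 0` for all skew `k`, that is, with `δ(K)` central. -/

namespace StarDer

/-! ### Semiprime rings without unit: annihilators and central elements. -/

section SemiprimeRings

variable {B : Type*} [NonUnitalRing B]

theorem IsSemiprimeRing.eq_zero_of_mul_left (hB : IsSemiprimeRing B) {a : B}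
    (h : ∀ r, a * r = 0) : a = 0 := by
  let L : TwoSidedIdeal B := .mk' {x | ∀ r, x * r = 0} (by simp)
    (fun {x y} hx hy r => by rw [add_mul, hx r, hy r, add_zero])
    (fun {x} hx r => by rw [neg_mul, hx r, neg_zero])
    (fun {x y} hy r => by rw [mul_assoc, hy r, mul_zero])
    (fun {x y} hx r => by rw [mul_assoc, hx])
  have hL : ∀ x, x ∈ L ↔ ∀ r, x * r = 0 := fun x => TwoSidedIdeal.mem_mk' _ _ _ _ _ _ x
  have := hB L (fun x hx y _ => (hL x).1 hx y)
  have ha : a ∈ L := (hL a).2 h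
  rwa [this, TwoSidedIdeal.mem_bot] at ha

/-- In a semiprime ring, `a B a = 0` forces `a = 0`. -/
theorem IsSemiprimeRing.eq_zero (hB : IsSemiprimeRing B) {a : B}
    (h : ∀ r, a * r * a = 0) : a = 0 := by
  -- Annihilator ideals replace the ideal generated by `a`, which is awkward without a unit. Both
  -- `V` and `W` contain `a`, and `V W V = 0`-type products vanish because elements of `V` kill `B
  -- W`.
  let V : TwoSidedIdeal B := .mk' {y | ∀ r, y * r * a = 0} (by simp)
    (fun {x y} hx hy r => by rw [add_mul, add_mul, hx r, hy r, add_zero])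
    (fun {x} hx r => by rw [neg_mul, neg_mul, hx r, neg_zero])
    (fun {x y} hy r => by rw [mul_assoc x, mul_assoc x, hy r, mul_zero])
    (fun {x y} hx r => by rw [mul_assoc x, hx])
  have hV : ∀ x, x ∈ V ↔ ∀ r, x * r * a = 0 := fun x => TwoSidedIdeal.mem_mk' _ _ _ _ _ _ x
  let W : TwoSidedIdeal B := .mk' {x | ∀ y ∈ V, ∀ r, y * r * x = 0} (by simp)
    (fun {x z} hx hz y hy r => by rw [mul_add, hx y hy, hz y hy, add_zero])
    (fun {x} hx y hy r => by rw [mul_neg, hx y hy, neg_zero])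
    (fun {x z} hz y hy r => by rw [← mul_assoc, mul_assoc y, hz y hy])
    (fun {x z} hx y hy r => by rw [← mul_assoc, hx y hy, zero_mul])
  have hW : ∀ x, x ∈ W ↔ ∀ y ∈ V, ∀ r, y * r * x = 0 :=
    fun x => TwoSidedIdeal.mem_mk' _ _ _ _ _ _ x
  have haV : a ∈ V := (hV a).2 h
  have haW : a ∈ W := (hW a).2 fun y hy r => (hV y).1 hy r
  -- Only triple products in `V ⊓ W` are known to vanish. So `N`, the part of `V ⊓ W` annihilating
  -- `V ⊓ W`, has square zero and contains all products of two elements of `V ⊓ W`; semiprimeness is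
  -- used twice.
  let N : TwoSidedIdeal B := .mk' {n | (n ∈ V ∧ n ∈ W) ∧ ∀ m, m ∈ V → m ∈ W → n * m = 0}
    ⟨⟨V.zero_mem, W.zero_mem⟩, by simp⟩
    (fun {x y} hx hy => ⟨⟨V.add_mem hx.1.1 hy.1.1, W.add_mem hx.1.2 hy.1.2⟩,
      fun m h1 h2 => by rw [add_mul, hx.2 m h1 h2, hy.2 m h1 h2, add_zero]⟩)
    (fun {x} hx => ⟨⟨V.neg_mem hx.1.1, W.neg_mem hx.1.2⟩,
      fun m h1 h2 => by rw [neg_mul, hx.2 m h1 h2, neg_zero]⟩)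
    (fun {x y} hy => ⟨⟨V.mul_mem_left _ _ hy.1.1, W.mul_mem_left _ _ hy.1.2⟩,
      fun m h1 h2 => by rw [mul_assoc, hy.2 m h1 h2, mul_zero]⟩)
    (fun {x y} hx => ⟨⟨V.mul_mem_right _ _ hx.1.1, W.mul_mem_right _ _ hx.1.2⟩,
      fun m h1 h2 => by
        rw [mul_assoc, hx.2 _ (V.mul_mem_left _ _ h1) (W.mul_mem_left _ _ h2)]⟩)
  have hN : ∀ x, x ∈ N ↔ ((x ∈ V ∧ x ∈ W) ∧ ∀ m, m ∈ V → m ∈ W → x * m = 0) :=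
    fun x => TwoSidedIdeal.mem_mk' _ _ _ _ _ _ x
  have hN0 : N = ⊥ := hB N fun x hx y hy =>
    ((hN x).1 hx).2 y ((hN y).1 hy).1.1 ((hN y).1 hy).1.2
  have hmul : ∀ x ∈ V ⊓ W, ∀ y ∈ V ⊓ W, x * y = 0 := by
    intro x hx y hy
    rw [TwoSidedIdeal.mem_inf] at hx hy
    have : x * y ∈ N := (hN _).2 ⟨⟨V.mul_mem_left _ _ hy.1, W.mul_mem_left _ _ hy.2⟩,
      fun m _ h2 => (hW m).1 h2 x hx.1 y⟩
    rwa [hN0, TwoSidedIdeal.mem_bot] at this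
  have : a ∈ V ⊓ W := (TwoSidedIdeal.mem_inf _).2 ⟨haV, haW⟩
  rwa [hB _ hmul, TwoSidedIdeal.mem_bot] at this

theorem IsSemiprimeRing.mul_mul_eq_zero_comm (hB : IsSemiprimeRing B) {a b : B}
    (h : ∀ r, a * r * b = 0) (r : B) : b * r * a = 0 := by
  refine hB.eq_zero fun t => ?_
  rw [show b * r * a * t * (b * r * a) = b * r * (a * t * b) * r * a by simp only [mul_assoc],
    h, mul_zero, zero_mul, zero_mul]

theorem mul_comm_of_mem_center {z : B} (hz : z ∈ NonUnitalSubring.center B) (a : B) :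
    z * a = a * z :=
  (NonUnitalSubring.mem_center_iff.1 hz a).symm

theorem IsSemiprimeRing.eq_zero_of_central_sq (hB : IsSemiprimeRing B) {z : B}
    (hz : z ∈ NonUnitalSubring.center B) (h : z * z = 0) : z = 0 :=
  hB.eq_zero fun r => by rw [mul_comm_of_mem_center hz r, mul_assoc, h, mul_zero]

theorem IsSemiprimeRing.eq_zero_of_central_cube (hB : IsSemiprimeRing B) {z : B}
    (hz : z ∈ NonUnitalSubring.center B) (h : z * z * z = 0) : z = 0 :=
  hB.eq_zero_of_central_sq hz (hB.eq_zero_of_central_sq (mul_mem hz hz)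
    (by rw [← mul_assoc, h, zero_mul]))

/-- An element `d` of a semiprime ring with `[d, [d, a]] = 0` for all `a` is central. -/
theorem IsSemiprimeRing.mem_center_of_double_commutator (hB : IsSemiprimeRing B)
    (htor : ∀ b : B, b + b = 0 → b = 0) {d : B}
    (hd : ∀ a, d * (d * a - a * d) = (d * a - a * d) * d) : d ∈ NonUnitalSubring.center B := by
  -- The Leibniz rule for `[d, [d, a b]]` leaves only the cross term `2 [d, a] [d, b]`.
  have hmul : ∀ a b, (d * a - a * d) * (d * b - b * d) = 0 := by
    intro a b
    apply htor
    have e := sub_eq_zero.2 (hd (a * b))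
    have ea := congrArg (· * b) (sub_eq_zero.2 (hd a))
    have eb := congrArg (a * ·) (sub_eq_zero.2 (hd b))
    simp only [zero_mul, mul_zero] at ea eb
    have key : (d * a - a * d) * (d * b - b * d) + (d * a - a * d) * (d * b - b * d) =
        d * (d * (a * b) - a * b * d) - (d * (a * b) - a * b * d) * d -
          (d * (d * a - a * d) - (d * a - a * d) * d) * b -
          a * (d * (d * b - b * d) - (d * b - b * d) * d) := by
      simp only [mul_sub, sub_mul, mul_assoc]
      abel
    rw [key, e, ea, eb, sub_zero, sub_zero]
  rw [NonUnitalSubring.mem_center_iff]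
  intro g
  refine (sub_eq_zero.1 (hB.eq_zero fun c => ?_)).symm
  have key : (d * g - g * d) * c * (d * g - g * d) =
      (d * g - g * d) * (d * (c * g) - c * g * d) - (d * g - g * d) * (d * c - c * d) * g := by
    simp only [mul_sub, sub_mul, mul_assoc]
    abel
  rw [key, hmul, hmul, zero_mul, sub_zero]

/-- A semiprime ring in which every element is divisible by `2` has no `2`-torsion. -/
theorem IsSemiprimeRing.eq_zero_of_add_self (hB : IsSemiprimeRing B)
    (hdiv : ∀ b : B, ∃ c, c + c = b) {b : B} (h : b + b = 0) : b = 0 :=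
  hB.eq_zero_of_mul_left fun r => by
    obtain ⟨c, rfl⟩ := hdiv r
    rw [mul_add, ← add_mul, h, zero_mul]

end SemiprimeRings

/-! ### Cancellation in `*`-prime rings. -/

section StarPrimeRings

variable {B : Type*} [NonUnitalRing B] [StarRing B]

/-- If `N² = 0`, then `N ∩ N*` is a `*`-ideal of square zero, so it vanishes and with it `N N*` and
`N* N`. Hence the `*`-ideal `N + N*` has square zero too. -/
theorem IsStarPrime.isSemiprimeRing (hB : IsStarPrime B) : IsSemiprimeRing B := by
  intro N hN
  have sq : ∀ I : TwoSidedIdeal B, IsStarIdeal I → (∀ x ∈ I, ∀ y ∈ I, x * y = 0) → I = ⊥ :=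
    fun I h1 h2 => (hB.2 I I h1 h1 h2).elim id id
  let M : TwoSidedIdeal B := .mk' {x | x ∈ N ∧ star x ∈ N} (by simp [N.zero_mem])
    (fun {x y} hx hy => ⟨N.add_mem hx.1 hy.1, by rw [star_add]; exact N.add_mem hx.2 hy.2⟩)
    (fun {x} hx => ⟨N.neg_mem hx.1, by rw [star_neg]; exact N.neg_mem hx.2⟩)
    (fun {x y} hy => ⟨N.mul_mem_left _ _ hy.1,
      by rw [star_mul]; exact N.mul_mem_right _ _ hy.2⟩)
    (fun {x y} hx => ⟨N.mul_mem_right _ _ hx.1,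
      by rw [star_mul]; exact N.mul_mem_left _ _ hx.2⟩)
  have hM : ∀ x, x ∈ M ↔ (x ∈ N ∧ star x ∈ N) := fun x => TwoSidedIdeal.mem_mk' _ _ _ _ _ _ x
  have hM0 : M = ⊥ := sq M
    (fun x hx => (hM _).2 ⟨((hM x).1 hx).2, by rw [star_star]; exact ((hM x).1 hx).1⟩)
    (fun x hx y hy => hN x ((hM x).1 hx).1 y ((hM y).1 hy).1)
  have h0 : ∀ x, x ∈ N → star x ∈ N → x = 0 := fun x h1 h2 => by
    have := (hM x).2 ⟨h1, h2⟩
    rwa [hM0, TwoSidedIdeal.mem_bot] at this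
  have h1 : ∀ x ∈ N, ∀ y ∈ N, x * star y = 0 := fun x hx y hy =>
    h0 _ (N.mul_mem_right _ _ hx) (by
      rw [star_mul, star_star]; exact N.mul_mem_right _ _ hy)
  have h2 : ∀ x ∈ N, ∀ y ∈ N, star x * y = 0 := fun x hx y hy =>
    h0 _ (N.mul_mem_left _ _ hy) (by
      rw [star_mul, star_star]; exact N.mul_mem_left _ _ hx)
  have h3 : ∀ x ∈ N, ∀ y ∈ N, star x * star y = 0 := fun x hx y hy => by
    rw [← star_mul, hN y hy x hx, star_zero]
  let S : TwoSidedIdeal B := .mk' {x | ∃ a ∈ N, ∃ b ∈ N, x = a + star b}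
    ⟨0, N.zero_mem, 0, N.zero_mem, by simp⟩
    (by rintro _ _ ⟨a, ha, b, hb, rfl⟩ ⟨c, hc, d, hd, rfl⟩
        exact ⟨a + c, N.add_mem ha hc, b + d, N.add_mem hb hd, by rw [star_add]; abel⟩)
    (by rintro _ ⟨a, ha, b, hb, rfl⟩
        exact ⟨-a, N.neg_mem ha, -b, N.neg_mem hb, by rw [star_neg]; abel⟩)
    (by rintro x _ ⟨a, ha, b, hb, rfl⟩
        exact ⟨x * a, N.mul_mem_left _ _ ha, b * star x, N.mul_mem_right _ _ hb,
          by rw [star_mul, star_star, mul_add]⟩)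
    (by rintro _ x ⟨a, ha, b, hb, rfl⟩
        exact ⟨a * x, N.mul_mem_right _ _ ha, star x * b, N.mul_mem_left _ _ hb,
          by rw [star_mul, star_star, add_mul]⟩)
  have hS : ∀ x, x ∈ S ↔ ∃ a ∈ N, ∃ b ∈ N, x = a + star b :=
    fun x => TwoSidedIdeal.mem_mk' _ _ _ _ _ _ x
  have hS0 : S = ⊥ := by
    refine sq S (fun x hx => ?_) (fun x hx y hy => ?_)
    · obtain ⟨a, ha, b, hb, rfl⟩ := (hS x).1 hx
      exact (hS _).2 ⟨b, hb, a, ha, by rw [star_add, star_star, add_comm]⟩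
    · obtain ⟨a, ha, b, hb, rfl⟩ := (hS x).1 hx
      obtain ⟨c, hc, d, hd, rfl⟩ := (hS y).1 hy
      rw [add_mul, mul_add, mul_add, hN a ha c hc, h1 a ha d hd, h2 b hb c hc, h3 b hb d hd]
      simp
  rw [eq_bot_iff]
  intro x hx
  rw [← hS0]
  exact (hS x).2 ⟨x, hx, 0, N.zero_mem, by simp⟩

/-- In a `*`-prime ring, `a B b = 0` and `a B b* = 0` force `a = 0` or `b = 0`. -/
theorem IsStarPrime.eq_zero_or_eq_zero (hB : IsStarPrime B) {a b : B}
    (h : ∀ r, a * r * b = 0) (h' : ∀ r, a * r * star b = 0) : a = 0 ∨ b = 0 := by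
  have hs := hB.isSemiprimeRing
  have flip : ∀ {x y : B}, (∀ r, x * r * y = 0) → ∀ r, star x * r * star y = 0 := by
    intro x y hxy r
    have := congrArg star (hs.mul_mul_eq_zero_comm hxy (star r))
    simpa [star_mul, mul_assoc] using this
  let I : TwoSidedIdeal B := .mk' {x | (∀ r, x * r * b = 0) ∧ ∀ r, x * r * star b = 0} (by simp)
    (fun {x y} hx hy => ⟨fun r => by rw [add_mul, add_mul, hx.1 r, hy.1 r, add_zero],
      fun r => by rw [add_mul, add_mul, hx.2 r, hy.2 r, add_zero]⟩)
    (fun {x} hx => ⟨fun r => by rw [neg_mul, neg_mul, hx.1 r, neg_zero],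
      fun r => by rw [neg_mul, neg_mul, hx.2 r, neg_zero]⟩)
    (fun {x y} hy => ⟨fun r => by rw [mul_assoc x, mul_assoc x, hy.1 r, mul_zero],
      fun r => by rw [mul_assoc x, mul_assoc x, hy.2 r, mul_zero]⟩)
    (fun {x y} hx => ⟨fun r => by rw [mul_assoc x, hx.1],
      fun r => by rw [mul_assoc x, hx.2]⟩)
  have hI : ∀ x, x ∈ I ↔ ((∀ r, x * r * b = 0) ∧ ∀ r, x * r * star b = 0) :=
    fun x => TwoSidedIdeal.mem_mk' _ _ _ _ _ _ x
  have hIs : IsStarIdeal I := fun x hx =>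
    (hI _).2 ⟨by simpa using flip ((hI x).1 hx).2, flip ((hI x).1 hx).1⟩
  let J : TwoSidedIdeal B := .mk' {y | ∀ x ∈ I, ∀ r, x * r * y = 0} (by simp)
    (fun {x z} hx hz y hy r => by rw [mul_add, hx y hy, hz y hy, add_zero])
    (fun {x} hx y hy r => by rw [mul_neg, hx y hy, neg_zero])
    (fun {x z} hz y hy r => by rw [← mul_assoc, mul_assoc y, hz y hy])
    (fun {x z} hx y hy r => by rw [← mul_assoc, hx y hy, zero_mul])
  have hJ : ∀ y, y ∈ J ↔ ∀ x ∈ I, ∀ r, x * r * y = 0 :=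
    fun x => TwoSidedIdeal.mem_mk' _ _ _ _ _ _ x
  have hJs : IsStarIdeal J := fun y hy => (hJ _).2 fun x hx r => by
    simpa using flip ((hJ y).1 hy (star x) (hIs x hx)) r
  rcases hB.2 I J hIs hJs (fun x hx y hy => hs.eq_zero fun r => by
    rw [show x * y * r * (x * y) = x * (y * r * x) * y by simp only [mul_assoc],
      (hJ y).1 hy x hx]) with h0 | h0
  · left
    have : a ∈ I := (hI a).2 ⟨h, h'⟩
    rwa [h0, TwoSidedIdeal.mem_bot] at this
  · right
    have : b ∈ J := (hJ b).2 fun x hx => ((hI x).1 hx).1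
    rwa [h0, TwoSidedIdeal.mem_bot] at this

/-- A non-zero central element that is symmetric or skew is not a zero divisor. -/
theorem IsStarPrime.eq_zero_of_central_mul (hB : IsStarPrime B) {z a : B}
    (hz : z ∈ NonUnitalSubring.center B) (hs : star z = z ∨ star z = -z) (hz0 : z ≠ 0)
    (h : z * a = 0) : a = 0 := by
  have h' : z * star a = 0 := by
    have e := congrArg star h
    rw [star_mul, star_zero] at e
    rcases hs with hs | hs <;> rw [hs] at e
    · rwa [mul_comm_of_mem_center hz]
    · rw [mul_comm_of_mem_center hz, ← neg_eq_zero, ← mul_neg, e]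
  refine (hB.eq_zero_or_eq_zero (a := z) (b := a) (fun r => ?_) (fun r => ?_)).resolve_left hz0
  · rw [mul_comm_of_mem_center hz r, mul_assoc, h, mul_zero]
  · rw [mul_comm_of_mem_center hz r, mul_assoc, h', mul_zero]

end StarPrimeRings

/-! ### Existence of `*`-prime ideals, and their quotients. -/

section StarPrimeIdeals

theorem coe_eq_zero_iff {A : Type*} [NonUnitalRing A] (P : TwoSidedIdeal A) (x : A) :
    (x : P.ringCon.Quotient) = 0 ↔ x ∈ P := by
  rw [TwoSidedIdeal.mem_iff, ← P.ringCon.eq]; rfl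

variable {A : Type*} [NonUnitalRing A] [StarRing A]

/-- In a semiprime ring, for `a ≠ 0` there are `x`, `y` with `x y ≠ 0` that lie in every `*`-ideal
containing `a`. -/
theorem IsSemiprimeRing.exists_mul_mem (hA : IsSemiprimeRing A) {a : A} (ha : a ≠ 0) :
    ∃ x y : A, x * y ≠ 0 ∧ ∀ I : TwoSidedIdeal A, IsStarIdeal I → a ∈ I → x ∈ I ∧ y ∈ I := by
  let N : TwoSidedIdeal A := .mk' {x | ∀ I : TwoSidedIdeal A, IsStarIdeal I → a ∈ I → x ∈ I}
    (fun I _ _ => I.zero_mem)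
    (fun hx hy I h1 h2 => I.add_mem (hx I h1 h2) (hy I h1 h2))
    (fun hx I h1 h2 => I.neg_mem (hx I h1 h2))
    (fun hy I h1 h2 => I.mul_mem_left _ _ (hy I h1 h2))
    (fun hx I h1 h2 => I.mul_mem_right _ _ (hx I h1 h2))
  have hN : ∀ x, x ∈ N ↔ ∀ I : TwoSidedIdeal A, IsStarIdeal I → a ∈ I → x ∈ I :=
    fun x => TwoSidedIdeal.mem_mk' _ _ _ _ _ _ x
  by_contra! hcon
  have hN0 := hA N fun x hx y hy => by
    by_contra hxy
    obtain ⟨I, h1, h2, h3⟩ := hcon x y hxy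
    exact h3 ((hN x).1 hx I h1 h2) ((hN y).1 hy I h1 h2)
  have : a ∈ N := (hN a).2 fun I _ h => h
  rw [hN0, TwoSidedIdeal.mem_bot] at this
  exact ha this

theorem IsStarIdeal.sup {I J : TwoSidedIdeal A} (hI : IsStarIdeal I) (hJ : IsStarIdeal J) :
    IsStarIdeal (I ⊔ J) := by
  intro x hx
  obtain ⟨y, hy, z, hz, rfl⟩ := TwoSidedIdeal.mem_sup.1 hx
  rw [star_add]
  exact TwoSidedIdeal.mem_sup.2 ⟨_, hI y hy, _, hJ z hz, rfl⟩

/-- The `*`-prime ideals of a semiprime ring with involution intersect in zero. -/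
theorem IsSemiprimeRing.exists_isStarPrimeIdeal_notMem (hA : IsSemiprimeRing A) {a : A}
    (ha : a ≠ 0) : ∃ P : TwoSidedIdeal A, IsStarPrimeIdeal P ∧ a ∉ P := by
  choose f g hfg hI using fun b : {b : A // b ≠ 0} => hA.exists_mul_mem b.2
  -- A `*`-version of an m-sequence: each term is a non-zero product of two elements lying in every
  -- `*`-ideal that contains the previous term. A `*`-ideal maximal among those avoiding the
  -- sequence is `*`-prime.
  let s : ℕ → {b : A // b ≠ 0} := fun n =>
    Nat.rec ⟨a, ha⟩ (fun _ b => ⟨f b * g b, hfg b⟩) n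
  have hs : ∀ n, (s (n + 1)).1 = f (s n) * g (s n) := fun n => rfl
  have hmono : ∀ I : TwoSidedIdeal A, IsStarIdeal I → ∀ m n, m ≤ n → (s m).1 ∈ I →
      (s n).1 ∈ I := by
    intro I h1 m n hmn hm
    induction n, hmn using Nat.le_induction with
    | base => exact hm
    | succ n _ ih => rw [hs]; exact I.mul_mem_right _ _ (hI _ I h1 ih).1
  obtain ⟨P, -, hP⟩ := zorn_le_nonempty₀
    {P : TwoSidedIdeal A | IsStarIdeal P ∧ ∀ n, (s n).1 ∉ P} (by
      intro c hc hchain P₀ hP₀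
      let U : TwoSidedIdeal A := .mk' {x | ∃ I ∈ c, x ∈ I} ⟨P₀, hP₀, P₀.zero_mem⟩
        (by rintro x y ⟨I, hI, hx⟩ ⟨J, hJ, hy⟩
            rcases hchain.total hI hJ with h | h
            · exact ⟨J, hJ, J.add_mem (h hx) hy⟩
            · exact ⟨I, hI, I.add_mem hx (h hy)⟩)
        (by rintro x ⟨I, hI, hx⟩; exact ⟨I, hI, I.neg_mem hx⟩)
        (by rintro x y ⟨I, hI, hx⟩; exact ⟨I, hI, I.mul_mem_left _ _ hx⟩)
        (by rintro x y ⟨I, hI, hx⟩; exact ⟨I, hI, I.mul_mem_right _ _ hx⟩)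
      have hU : ∀ x, x ∈ U ↔ ∃ I ∈ c, x ∈ I := fun x => TwoSidedIdeal.mem_mk' _ _ _ _ _ _ x
      refine ⟨U, ⟨fun x hx => ?_, fun n hn => ?_⟩, fun I hI x hx => (hU x).2 ⟨I, hI, hx⟩⟩
      · obtain ⟨I, hI, hx⟩ := (hU x).1 hx
        exact (hU _).2 ⟨I, hI, (hc hI).1 x hx⟩
      · obtain ⟨I, hI, hx⟩ := (hU _).1 hn
        exact (hc hI).2 n hx)
    ⊥ ⟨fun x hx => by
      rw [TwoSidedIdeal.mem_bot] at hx ⊢; rw [hx, star_zero],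
      fun n hn => (s n).2 ((TwoSidedIdeal.mem_bot _).1 hn)⟩
  have key : ∀ I : TwoSidedIdeal A, IsStarIdeal I → ¬ I ≤ P → ∃ n, (s n).1 ∈ I ⊔ P := by
    intro I hI hIP
    by_contra! hcon
    exact hIP (le_sup_left.trans (hP.2 ⟨hI.sup hP.1.1, hcon⟩ le_sup_right))
  refine ⟨P, ⟨hP.1.1, ?_, ?_⟩, hP.1.2 0⟩
  · rintro rfl
    exact hP.1.2 0 trivial
  · intro I J hI' hJ' hIJ
    by_contra! hcon
    obtain ⟨m, hm⟩ := key I hI' hcon.1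
    obtain ⟨n, hn⟩ := key J hJ' hcon.2
    have hm' := hmono _ (hI'.sup hP.1.1) m (max m n) (le_max_left _ _) hm
    have hn' := hmono _ (hJ'.sup hP.1.1) n (max m n) (le_max_right _ _) hn
    obtain ⟨x, hx, p, hp, e1⟩ := TwoSidedIdeal.mem_sup.1 (hI _ _ (hI'.sup hP.1.1) hm').1
    obtain ⟨y, hy, q, hq, e2⟩ := TwoSidedIdeal.mem_sup.1 (hI _ _ (hJ'.sup hP.1.1) hn').2
    -- Both factors of the term after `max m n` are available, one in `I ⊔ P` and one in `J ⊔ P`;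
    -- their product lies in `P`.
    apply hP.1.2 (max m n + 1)
    rw [hs, ← e1, ← e2, mul_add, add_mul]
    exact P.add_mem (P.add_mem (hIJ x hx y hy) (P.mul_mem_right _ _ hp)) (P.mul_mem_left _ _ hq)

/-- The involution induced on the quotient by a `*`-ideal. -/
@[reducible]
def quotientStarRing {P : TwoSidedIdeal A} (hP : IsStarIdeal P) :
    StarRing P.ringCon.Quotient where
  star := Quotient.map' star fun x y h => by
    have h' := (TwoSidedIdeal.rel_iff P x y).1 h
    refine (TwoSidedIdeal.rel_iff P _ _).2 ?_
    rw [← star_sub]; exact hP _ h'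
  star_involutive x := by
    induction x using Quotient.inductionOn' with
    | h x => exact congrArg Quotient.mk'' (star_star x)
  star_mul x y := by
    induction x using Quotient.inductionOn' with
    | h x =>
      induction y using Quotient.inductionOn' with
      | h y => exact congrArg Quotient.mk'' (star_mul x y)
  star_add x y := by
    induction x using Quotient.inductionOn' with
    | h x =>
      induction y using Quotient.inductionOn' with
      | h y => exact congrArg Quotient.mk'' (star_add x y)

theorem IsStarPrimeIdeal.isStarPrime_quotient {P : TwoSidedIdeal A} (hP : IsStarPrimeIdeal P) :
    @IsStarPrime P.ringCon.Quotient _ (quotientStarRing hP.1) := by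
  let _ := quotientStarRing hP.1
  refine ⟨?_, fun I J hI hJ hIJ => ?_⟩
  · obtain ⟨x, hx⟩ : ∃ x, x ∉ P := by
      by_contra! h
      exact hP.2.1 (TwoSidedIdeal.ext fun x => ⟨fun _ => trivial, fun _ => h x⟩)
    exact ⟨(x : P.ringCon.Quotient), 0, fun h => hx ((coe_eq_zero_iff P x).1 h)⟩
  · let π : A →ₙ+* P.ringCon.Quotient :=
      { toFun := fun x => (x : P.ringCon.Quotient)
        map_mul' := fun _ _ => rfl
        map_zero' := rfl
        map_add' := fun _ _ => rfl }
    have hbot : ∀ I : TwoSidedIdeal P.ringCon.Quotient, I.comap π ≤ P → I = ⊥ := by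
      intro I h
      rw [eq_bot_iff]
      intro x hx
      induction x using Quotient.inductionOn' with
      | h x =>
        have : x ∈ P := h ((TwoSidedIdeal.mem_comap (f := π)).2 hx)
        exact (TwoSidedIdeal.mem_bot _).2 ((coe_eq_zero_iff P x).2 this)
    refine (hP.2.2 (I.comap π) (J.comap π) (fun x hx => ?_) (fun x hx => ?_)
      (fun x hx y hy => ?_)).imp (hbot I) (hbot J)
    · rw [TwoSidedIdeal.mem_comap] at hx ⊢
      exact hI _ hx
    · rw [TwoSidedIdeal.mem_comap] at hx ⊢
      exact hJ _ hx
    · rw [TwoSidedIdeal.mem_comap] at hx hy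
      exact (coe_eq_zero_iff P _).1 (hIJ _ hx _ hy)

end StarPrimeIdeals

/-! ### Conditions forcing degree at most two. -/

section LowDegree

variable {B : Type*} [NonUnitalRing B]

/-- The ideal `w B` for a central element `w`. -/
def centralMultiples {w : B} (hw : w ∈ NonUnitalSubring.center B) : TwoSidedIdeal B :=
  .mk' {y | ∃ u, y = w * u} ⟨0, by simp⟩
    (by rintro _ _ ⟨u, rfl⟩ ⟨v, rfl⟩; exact ⟨u + v, (mul_add _ _ _).symm⟩)
    (by rintro _ ⟨u, rfl⟩; exact ⟨-u, (mul_neg _ _).symm⟩)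
    (by rintro x _ ⟨u, rfl⟩
        exact ⟨x * u, by rw [← mul_assoc, ← mul_comm_of_mem_center hw, mul_assoc]⟩)
    (by rintro _ x ⟨u, rfl⟩; exact ⟨u * x, mul_assoc _ _ _⟩)

theorem mem_centralMultiples {w : B} (hw : w ∈ NonUnitalSubring.center B) {y : B} :
    y ∈ centralMultiples hw ↔ ∃ u, y = w * u :=
  TwoSidedIdeal.mem_mk' _ _ _ _ _ _ y

open Classical in
/-- The map `w u ↦ s u`, extended by zero. -/
noncomputable def fractionMap (w s y : B) : B :=
  if h : ∃ u, y = w * u then s * h.choose else 0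

theorem fractionMap_mul {w : B} (hreg : ∀ a, w * a = 0 → a = 0) (s u : B) :
    fractionMap w s (w * u) = s * u := by
  have h : ∃ v, w * u = w * v := ⟨u, rfl⟩
  rw [fractionMap, dif_pos h]
  congr 1
  exact (sub_eq_zero.1 (hreg _ (by rw [mul_sub, ← h.choose_spec, sub_self]))).symm

/-- The fraction `s / w` of central elements, as an element of the extended centroid. -/
noncomputable def centralFraction (hB : IsSemiprimeRing B) {w s : B}
    (hw : w ∈ NonUnitalSubring.center B) (hs : s ∈ NonUnitalSubring.center B)
    (hreg : ∀ a, w * a = 0 → a = 0) : PartialCentralizer B where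
  dom := centralMultiples hw
  dense a ha := hB.eq_zero_of_mul_left fun r => hreg _ (by
    rw [← mul_assoc, mul_comm_of_mem_center hw, mul_assoc]
    exact ha _ ((mem_centralMultiples hw).2 ⟨r, rfl⟩))
  toFun := fractionMap w s
  map_add := by
    intro y hy z hz
    obtain ⟨u, rfl⟩ := (mem_centralMultiples hw).1 hy
    obtain ⟨v, rfl⟩ := (mem_centralMultiples hw).1 hz
    simp only [← mul_add, fractionMap_mul hreg]
  map_mul_left := by
    intro r y hy
    obtain ⟨u, rfl⟩ := (mem_centralMultiples hw).1 hy
    rw [← mul_assoc, ← mul_comm_of_mem_center hw, mul_assoc, fractionMap_mul hreg,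
      fractionMap_mul hreg, ← mul_assoc, mul_comm_of_mem_center hs, mul_assoc]
  map_mul_right := by
    intro r y hy
    obtain ⟨u, rfl⟩ := (mem_centralMultiples hw).1 hy
    rw [mul_assoc, fractionMap_mul hreg, fractionMap_mul hreg, mul_assoc]

/-- If `z b = t + m` with `z` central and regular, `t` central and `m ^ 2` central, then `b` is a
root of a monic quadratic polynomial over the extended centroid. -/
theorem isAlgebraicOfDegree_two (hB : IsSemiprimeRing B) {b z t m : B}
    (hz : z ∈ NonUnitalSubring.center B) (hreg : ∀ a, z * a = 0 → a = 0)
    (ht : t ∈ NonUnitalSubring.center B) (hm : m * m ∈ NonUnitalSubring.center B)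
    (hb : z * b = t + m) : IsAlgebraicOfDegree b 2 := by
  have hreg' : ∀ a, z * z * a = 0 → a = 0 := fun a h => hreg _ (hreg _ (by rwa [← mul_assoc]))
  have h1 : -(z * t + z * t) ∈ NonUnitalSubring.center B :=
    neg_mem (add_mem (mul_mem hz ht) (mul_mem hz ht))
  have h0 : t * t - m * m ∈ NonUnitalSubring.center B := sub_mem (mul_mem ht ht) hm
  -- Squaring `z b - t = m` and dividing by `z²` gives `b² - (2 z t / z²) b + (t² - m²) / z² = 0`.
  -- Both coefficients get the denominator `z²`, so that they share a domain.
  refine ⟨![centralFraction hB (mul_mem hz hz) h0 hreg',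
    centralFraction hB (mul_mem hz hz) h1 hreg'], centralMultiples (mul_mem hz hz),
    (centralFraction hB (mul_mem hz hz) h0 hreg').dense, ?_, ?_⟩
  · intro i
    fin_cases i <;> exact le_rfl
  · intro y hy
    obtain ⟨u, rfl⟩ := (mem_centralMultiples _).1 hy
    have e : b * (z * z * u) = z * z * (b * u) := by
      rw [← mul_assoc, ← mul_comm_of_mem_center (mul_mem hz hz), mul_assoc]
    simp only [Fin.sum_univ_two, Matrix.cons_val_zero, Matrix.cons_val_one, Fin.val_zero,
      Fin.val_one, Function.iterate_succ, Function.iterate_zero, Function.comp, id, e,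
      centralFraction, fractionMap_mul hreg']
    have hmm : m = z * b - t := by rw [hb]; abel
    have htz := mul_comm_of_mem_center ht z
    have htb := mul_comm_of_mem_center ht b
    have e2 : b * (z * z * (b * u)) = z * z * (b * (b * u)) := by
      rw [← mul_assoc, ← mul_comm_of_mem_center (mul_mem hz hz), mul_assoc]
    have e3 : z * b * (z * b) = z * z * (b * b) := by
      rw [mul_assoc, ← mul_assoc b, ← mul_comm_of_mem_center hz b]; simp only [mul_assoc]
    have e4 : m * m = z * z * (b * b) - (z * t * b + z * t * b) + t * t := by
      rw [hmm, sub_mul, mul_sub, mul_sub, e3, ← mul_assoc t, htz, mul_assoc z b t, ← htb]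
      simp only [mul_assoc]
      abel
    rw [e2, e4]
    simp only [sub_mul, add_mul, neg_mul, mul_assoc]
    abel

theorem ringDegree_le_two (h : ∀ b : B, IsAlgebraicOfDegree b 2) : ringDegree B ≤ 2 :=
  iSup_le fun b => iInf₂_le 2 (h b)

theorem mem_center_of_add_self (htor : ∀ b : B, b + b = 0 → b = 0) {a : B}
    (h : a + a ∈ NonUnitalSubring.center B) : a ∈ NonUnitalSubring.center B := by
  rw [NonUnitalSubring.mem_center_iff] at h ⊢
  intro g
  refine sub_eq_zero.1 (htor _ ?_)
  have := h g
  rw [mul_add, add_mul] at this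
  rw [← sub_eq_zero] at this
  rw [← this]; abel

theorem mem_center_of_mul {z a : B} (hz : z ∈ NonUnitalSubring.center B)
    (hreg : ∀ a, z * a = 0 → a = 0) (h : z * a ∈ NonUnitalSubring.center B) :
    a ∈ NonUnitalSubring.center B := by
  rw [NonUnitalSubring.mem_center_iff] at h ⊢
  intro g
  refine sub_eq_zero.1 (hreg _ ?_)
  have := h g
  rw [← mul_assoc, ← mul_comm_of_mem_center hz, mul_assoc, mul_assoc] at this
  rw [mul_sub, this, sub_self]

variable [StarRing B]

theorem exists_symm_add_skew (hdiv : ∀ b : B, ∃ c, c + c = b) (b : B) :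
    ∃ h k : B, star h = h ∧ star k = -k ∧ b = h + k := by
  obtain ⟨c, rfl⟩ := hdiv b
  exact ⟨c + star c, c - star c, by rw [star_add, star_star, add_comm],
    by rw [star_sub, star_star, neg_sub], by abel⟩

/-- If the square of every skew element of a semiprime ring vanishes, there are none but `0`. -/
theorem skew_eq_zero_of_sq_eq_zero (hB : IsSemiprimeRing B) (hdiv : ∀ b : B, ∃ c, c + c = b)
    (hsq : ∀ x : B, star x = -x → x * x = 0) {x : B} (hx : star x = -x) : x = 0 := by
  have hxx := hsq x hx
  have hk : ∀ k : B, star k = -k → x * k * x = 0 := by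
    intro k hk
    have h := hsq (x + k) (by rw [star_add, hx, hk]; abel)
    rw [add_mul, mul_add, mul_add, hxx, hsq k hk, zero_add, add_zero] at h
    rw [eq_neg_of_add_eq_zero_left h, neg_mul, mul_assoc, hxx, mul_zero, neg_zero]
  have hh : ∀ h : B, star h = h → x * h * x * h * x = 0 := by
    intro h hh
    have e := congrArg (x * · * x) (hsq (x * h + h * x)
      (by rw [star_add, star_mul, star_mul, hx, hh]; simp only [mul_neg, neg_mul]; abel))
    have z1 : ∀ c, x * (x * c) = 0 := fun c => by rw [← mul_assoc, hxx, zero_mul]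
    simp only [mul_add, add_mul, mul_assoc, hxx, z1, mul_zero, zero_add, add_zero] at e
    -- The element `h x h` is again skew.
    simpa only [mul_assoc] using hk (h * x * h) (by
      rw [star_mul, star_mul, hx, hh]; simp only [mul_neg, neg_mul, mul_assoc])
  have hb : ∀ b, x * b * x * b * x = 0 := by
    intro b
    obtain ⟨h, k, h1, h2, rfl⟩ := exists_symm_add_skew hdiv b
    have e : x * (h + k) * x = x * h * x := by rw [mul_add, add_mul, hk k h2, add_zero]
    rw [e, mul_assoc (x * h), mul_assoc (x * h), e, ← mul_assoc, ← mul_assoc, hh h h1]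
  -- Polarizing `x b x b x = 0` gives `x b x c x = -x c x b x`, hence `(x b x) c (x b x) = 0`.
  refine hB.eq_zero fun b => hB.eq_zero fun c => ?_
  have h := hb (b + c)
  simp only [mul_add, add_mul, hb, zero_add, add_zero] at h
  have h' : x * b * x * c * x = -(x * c * x * b * x) := eq_neg_of_add_eq_zero_right (by
    rw [← h])
  rw [← mul_assoc, ← mul_assoc, h', neg_mul, neg_mul,
    show x * c * x * b * x * b * x = x * c * (x * b * x * b * x) by simp only [mul_assoc],
    hb, mul_zero, neg_zero]

section SkewAnticommutators

variable (hB : IsStarPrime B) (htor : ∀ b : B, b + b = 0 → b = 0)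
  (hK : ∀ x y : B, star x = -x → star y = -y → x * y + y * x ∈ NonUnitalSubring.center B)
include htor hK

theorem skew_sq_mem_center {x : B} (hx : star x = -x) : x * x ∈ NonUnitalSubring.center B :=
  mem_center_of_add_self htor (hK x x hx hx)

/-- Twice this element is the anticommutator of `x` with the skew element `x h + h x`. -/
theorem symm_conj_add_mem_center {x h : B} (hx : star x = -x) (hh : star h = h) :
    x * h * x + x * x * h ∈ NonUnitalSubring.center B := by
  apply mem_center_of_add_self htor
  have hxx := mul_comm_of_mem_center (skew_sq_mem_center htor hK hx) h
  have := hK (x * h + h * x) x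
    (by rw [star_add, star_mul, star_mul, hx, hh]; simp only [mul_neg, neg_mul]; abel) hx
  convert this using 1
  rw [add_mul, mul_add, mul_assoc h, ← hxx]
  simp only [mul_assoc]
  abel

/-- Here `x m x + x² m = 2 x² m`, and the central `x²` can be cancelled. -/
theorem symm_mem_center_of_commute {x m : B} (hx : star x = -x)
    (hreg : ∀ a, x * x * a = 0 → a = 0) (hm : star m = m) (hxm : x * m = m * x) :
    m ∈ NonUnitalSubring.center B := by
  refine mem_center_of_mul (skew_sq_mem_center htor hK hx) hreg (mem_center_of_add_self htor ?_)
  have := symm_conj_add_mem_center htor hK hx hm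
  rwa [mul_assoc, ← hxm, ← mul_assoc] at this

theorem symm_sq_mem_center_of_anticommute {x p : B} (hx : star x = -x)
    (hreg : ∀ a, x * x * a = 0 → a = 0) (hp : star p = p) (hxp : x * p = -(p * x)) :
    p * p ∈ NonUnitalSubring.center B := by
  refine symm_mem_center_of_commute htor hK hx hreg (by rw [star_mul, hp]) ?_
  rw [← mul_assoc, hxp, neg_mul, mul_assoc, hxp, mul_neg, neg_neg, mul_assoc]

include hB

/-- The commutator `e = [p, k]` is symmetric and commutes with `x`, so it is central. Since `k²` is
central, `2 e k = [p, k²] = 0`; so `e = 0`, or `e` is cancellable and `k = 0`. -/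
theorem commute_of_anticommute {x p k : B} (hx : star x = -x)
    (hreg : ∀ a, x * x * a = 0 → a = 0) (hp : star p = p) (hxp : x * p = -(p * x))
    (hk : star k = -k) (hxk : x * k = -(k * x)) : p * k = k * p := by
  have hes : star (p * k - k * p) = p * k - k * p := by
    rw [star_sub, star_mul, star_mul, hp, hk, neg_mul, mul_neg]; abel
  have he : p * k - k * p ∈ NonUnitalSubring.center B := by
    refine symm_mem_center_of_commute htor hK hx hreg hes ?_
    rw [mul_sub, sub_mul, ← mul_assoc, ← mul_assoc, hxp, hxk, neg_mul, neg_mul, mul_assoc p,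
      mul_assoc k, hxp, hxk, mul_neg, mul_neg, neg_neg, neg_neg, mul_assoc, mul_assoc]
  have hkk := mul_comm_of_mem_center (skew_sq_mem_center htor hK hk) p
  have hek : (p * k - k * p) * k = 0 := by
    apply htor
    nth_rw 2 [mul_comm_of_mem_center he]
    rw [sub_mul, mul_sub, mul_assoc p, ← hkk]
    simp only [mul_assoc]
    abel
  by_cases h0 : p * k - k * p = 0
  · exact sub_eq_zero.1 h0
  · rw [hB.eq_zero_of_central_mul he (Or.inl hes) h0 hek, mul_zero, zero_mul]

theorem mul_eq_zero_of_anticommute {x p k : B} (hx : star x = -x)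
    (hreg : ∀ a, x * x * a = 0 → a = 0) (hp : star p = p) (hxp : x * p = -(p * x))
    (hk : star k = -k) (hxk : x * k = -(k * x)) : p * k = 0 := by
  have h1 := commute_of_anticommute hB htor hK hx hreg hp hxp hk hxk
  -- The element `x k` is also skew and anticommutes with `x`. So `p` commutes with `k` and `x k`
  -- but anticommutes with `x`, which gives `2 x p k = 0`.
  have h2 := commute_of_anticommute hB htor hK hx hreg hp hxp (k := x * k)
    (by rw [star_mul, hx, hk, neg_mul_neg, hxk, neg_neg]) (by rw [mul_assoc, ← mul_neg, ← hxk])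
  have hpx : p * x = -(x * p) := by rw [hxp, neg_neg]
  rw [mul_assoc, ← h1, ← mul_assoc, ← mul_assoc, hpx, neg_mul, neg_eq_iff_add_eq_zero] at h2
  refine hreg _ ?_
  rw [mul_assoc, ← mul_assoc x p, htor _ h2, mul_zero]

/-- Split `2 x² b` into parts commuting and anticommuting with `x`. The symmetric commuting part is
central and the skew one is `c x` with `c` central. The anticommuting parts `p` (symmetric) and `l`
(skew) satisfy `p l = l p = 0` and have central squares, so `(p + l + c x)² = p² + l² + c² x²` is
central. -/
theorem isAlgebraicOfDegree_two_of_skew (hdiv : ∀ b : B, ∃ c, c + c = b) {x : B}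
    (hx : star x = -x) (hxx : x * x ≠ 0) (b : B) : IsAlgebraicOfDegree b 2 := by
  have hw := skew_sq_mem_center htor hK hx
  have hws : star (x * x) = x * x := by rw [star_mul, hx, neg_mul_neg]
  have hreg : ∀ a, x * x * a = 0 → a = 0 := fun a =>
    hB.eq_zero_of_central_mul hw (Or.inl hws) hxx
  have hreg2 : ∀ a, (x * x + x * x) * a = 0 → a = 0 := fun a h =>
    hreg a (htor _ (by rwa [add_mul] at h))
  obtain ⟨h, k, hh, hk, rfl⟩ := exists_symm_add_skew hdiv b
  have hc := hK x k hx hk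
  have hcs : star (x * k + k * x) = x * k + k * x := by
    rw [star_add, star_mul, star_mul, hx, hk, neg_mul_neg, neg_mul_neg, add_comm]
  obtain ⟨c, hc_def⟩ : ∃ c, c = x * k + k * x := ⟨_, rfl⟩
  rw [← hc_def] at hc hcs
  have hcx := mul_comm_of_mem_center hc x
  have hwc := mul_comm_of_mem_center hw
  -- the component of `h` anticommuting with `x`
  obtain ⟨p, hp_def⟩ : ∃ p, p = x * x * h - x * h * x := ⟨_, rfl⟩
  have hp : star p = p := by
    rw [hp_def, star_sub, star_mul, star_mul, star_mul, star_mul, hx, hh, neg_mul_neg, ← hwc]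
    simp only [neg_mul, mul_neg, neg_neg, mul_assoc]
  have hxp : x * p = -(p * x) := by
    have e : x * h * x * x = x * (x * x * h) := by rw [mul_assoc, mul_assoc, ← hwc]
    rw [hp_def, mul_sub, sub_mul, e]
    simp only [mul_assoc]
    abel
  -- the component of `k` anticommuting with `x`
  obtain ⟨l, hl_def⟩ : ∃ l, l = (x * x + x * x) * k - c * x := ⟨_, rfl⟩
  have hl : star l = -l := by
    rw [hl_def, star_sub, star_mul, star_mul, star_add, hcs, hws, hk, hx, neg_mul, neg_mul,
      ← hcx, mul_add, ← hwc, add_mul]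
    simp only [neg_sub, sub_neg_eq_add, neg_add_rev]
    abel
  have hxl : x * l = -(l * x) := by
    have e : x * x * k * x = x * x * c - x * (x * x * k) := by
      rw [hc_def]
      simp only [mul_add, mul_assoc]
      abel
    have e' : c * x * x = x * x * c := by rw [mul_assoc, hwc]
    have e'' : x * (c * x) = x * x * c := by rw [hcx, mul_assoc]
    rw [hl_def, mul_sub, sub_mul, add_mul, add_mul, mul_add, e, e', e'']
    abel
  have hpl := mul_eq_zero_of_anticommute hB htor hK hx hreg hp hxp hl hxl
  have hlp := commute_of_anticommute hB htor hK hx hreg hp hxp hl hxl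
  rw [hpl] at hlp
  refine isAlgebraicOfDegree_two hB.isSemiprimeRing (add_mem hw hw) hreg2
    (symm_conj_add_mem_center htor hK hx hh) (m := p + l + c * x) ?_ ?_
  · have e1 : p * (c * x) = -(c * x * p) := by
      rw [← mul_assoc, ← mul_comm_of_mem_center hc, mul_assoc, mul_assoc, hxp, mul_neg, neg_neg]
    have e2 : l * (c * x) = -(c * x * l) := by
      rw [← mul_assoc, ← mul_comm_of_mem_center hc, mul_assoc, mul_assoc, hxl, mul_neg, neg_neg]
    have e3 : c * x * (c * x) = c * c * (x * x) := by
      rw [mul_assoc, ← mul_assoc x, ← hcx]; simp only [mul_assoc]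
    have e : (p + l + c * x) * (p + l + c * x) = p * p + l * l + c * c * (x * x) := by
      simp only [add_mul, mul_add, hpl, ← hlp, e1, e2, e3]
      abel
    rw [e]
    exact add_mem (add_mem (symm_sq_mem_center_of_anticommute htor hK hx hreg hp hxp)
      (skew_sq_mem_center htor hK hl)) (mul_mem (mul_mem hc hc) hw)
  · rw [hp_def, hl_def]
    simp only [add_mul, mul_add, mul_assoc]
    abel

/-- If the skew elements of a `*`-prime ring have central anticommutators, then the ring has degree
at most two. -/
theorem ringDegree_le_two_of_skew (hdiv : ∀ b : B, ∃ c, c + c = b) : ringDegree B ≤ 2 := by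
  refine ringDegree_le_two fun b => ?_
  by_cases hsq : ∀ x : B, star x = -x → x * x = 0
  · have hstar : ∀ b : B, star b = b := fun b => by
      obtain ⟨h, k, hh, hk, rfl⟩ := exists_symm_add_skew hdiv b
      rw [skew_eq_zero_of_sq_eq_zero hB.isSemiprimeRing hdiv hsq hk, add_zero, hh]
    have hcen : ∀ b : B, b ∈ NonUnitalSubring.center B := fun b =>
      NonUnitalSubring.mem_center_iff.2 fun g => by
        rw [← hstar (g * b), star_mul, hstar, hstar]
    have := hB.1
    obtain ⟨z, hz⟩ := exists_ne (0 : B)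
    exact isAlgebraicOfDegree_two hB.isSemiprimeRing (hcen z)
      (fun a => hB.eq_zero_of_central_mul (hcen z) (Or.inl (hstar z)) hz) (hcen (z * b))
      (m := 0) (hcen _) (add_zero _).symm
  · push Not at hsq
    obtain ⟨x, hx, hxx⟩ := hsq
    exact isAlgebraicOfDegree_two_of_skew hB htor hK hdiv hx hxx b

end SkewAnticommutators

/-- If a non-zero symmetric element of a `*`-prime ring anticommutes with all skew elements, then
the anticommutators of skew elements are central. -/
theorem skew_anticommutator_mem_center (hB : IsStarPrime B) (hdiv : ∀ b : B, ∃ c, c + c = b)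
    {s : B} (hs : star s = s) (hs0 : s ≠ 0) (hsx : ∀ x, star x = -x → s * x = -(x * s))
    {x y : B} (hx : star x = -x) (hy : star y = -y) :
    x * y + y * x ∈ NonUnitalSubring.center B := by
  have hsp := hB.isSemiprimeRing
  have htor : ∀ b : B, b + b = 0 → b = 0 := fun b => hsp.eq_zero_of_add_self hdiv
  -- the Lie ideal generated additively by products of skew elements
  let U := AddSubgroup.closure {u : B | ∃ x y, star x = -x ∧ star y = -y ∧ x * y = u}
  have hU : ∀ {x y : B}, star x = -x → star y = -y → x * y ∈ U := fun hx hy =>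
    AddSubgroup.subset_closure ⟨_, _, hx, hy, rfl⟩
  have hlie : ∀ u ∈ U, ∀ a, u * a - a * u ∈ U := by
    intro u hu a
    induction hu using AddSubgroup.closure_induction with
    | mem u hu =>
      obtain ⟨x, y, hx, hy, rfl⟩ := hu
      obtain ⟨h, k, hh, hk, rfl⟩ := exists_symm_add_skew hdiv a
      have e : x * y * (h + k) - (h + k) * (x * y) = x * (y * h + h * y) - (x * h + h * x) * y
          + (x * (y * k - k * y) + (x * k - k * x) * y) := by
        simp only [mul_add, add_mul, mul_sub, sub_mul, mul_assoc]
        abel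
      have anti : ∀ {z : B}, star z = -z → star (z * h + h * z) = -(z * h + h * z) := by
        intro z hz
        rw [star_add, star_mul, star_mul, hz, hh, mul_neg, neg_mul, neg_add, add_comm]
      have comm : ∀ {z : B}, star z = -z → star (z * k - k * z) = -(z * k - k * z) := by
        intro z hz
        rw [star_sub, star_mul, star_mul, hz, hk, neg_mul_neg, neg_mul_neg, neg_sub]
      rw [e]
      exact add_mem (sub_mem (hU hx (anti hy)) (hU (anti hx) hy))
        (add_mem (hU hx (comm hy)) (hU (comm hx) hy))
    | zero => simp
    | add u v _ _ hu hv =>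
      rw [show (u + v) * a - a * (u + v) = (u * a - a * u) + (v * a - a * v) by
        rw [add_mul, mul_add]; abel]
      exact add_mem hu hv
    | neg u _ hu =>
      rw [show -u * a - a * -u = -(u * a - a * u) by rw [neg_mul, mul_neg]; abel]
      exact neg_mem hu
  have hsU : ∀ u ∈ U, s * u = u * s := by
    intro u hu
    induction hu using AddSubgroup.closure_induction with
    | mem u hu =>
      obtain ⟨x, y, hx, hy, rfl⟩ := hu
      rw [← mul_assoc, hsx x hx, neg_mul, mul_assoc, hsx y hy, mul_neg, neg_neg, mul_assoc]
    | zero => simp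
    | add u v _ _ hu hv => rw [mul_add, add_mul, hu, hv]
    | neg u _ hu => rw [mul_neg, neg_mul, hu]
  -- Since `[u, v] a = [u, v a] - v [u, a]` is built from elements of `U`, it commutes with `s`, as
  -- does `[u, v]`.
  have hprod : ∀ u ∈ U, ∀ v ∈ U, ∀ a, (u * v - v * u) * (s * a - a * s) = 0 := by
    intro u hu v hv a
    have e : (u * v - v * u) * a = (u * (v * a) - v * a * u) - v * (u * a - a * u) := by
      simp only [mul_sub, sub_mul, mul_assoc]
      abel
    have e1 : s * ((u * v - v * u) * a) = (u * v - v * u) * a * s := by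
      have h1 : s * (v * (u * a - a * u)) = v * (u * a - a * u) * s := by
        rw [← mul_assoc, hsU v hv, mul_assoc, hsU _ (hlie u hu a), mul_assoc]
      rw [e, mul_sub, h1, hsU _ (hlie u hu (v * a)), ← sub_mul]
    have e2 := hsU _ (hlie u hu v)
    rw [mul_sub, ← mul_assoc, ← e2, mul_assoc s, e1, ← mul_assoc, sub_self]
  by_cases hcs : ∀ a, s * a - a * s = 0
  · have hsc : s ∈ NonUnitalSubring.center B :=
      NonUnitalSubring.mem_center_iff.2 fun g => (sub_eq_zero.1 (hcs g)).symm
    have h0 : s * x = 0 := htor _ (by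
      nth_rw 1 [hsx x hx]
      rw [mul_comm_of_mem_center hsc, neg_add_cancel])
    rw [hB.eq_zero_of_central_mul hsc (Or.inl hs) hs0 h0, mul_zero, zero_mul, add_zero]
    exact zero_mem _
  · push Not at hcs
    obtain ⟨a, ha⟩ := hcs
    -- If `s` is not central, `*`-primeness makes the Lie ideal `U` commutative; its elements then
    -- have zero double commutators and are central.
    have hcomm : ∀ u ∈ U, ∀ v ∈ U, u * v = v * u := by
      intro u hu v hv
      have h0 : ∀ a r, (u * v - v * u) * r * (s * a - a * s) = 0 := by
        intro a r
        have e : (u * v - v * u) * r * (s * a - a * s) = (u * v - v * u) * (s * (r * a) - r * a * s)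
            - (u * v - v * u) * (s * r - r * s) * a := by
          simp only [mul_sub, sub_mul, mul_assoc]
          abel
        rw [e, hprod u hu v hv, hprod u hu v hv, zero_mul, sub_zero]
      have hst : star (s * a - a * s) = -(s * star a - star a * s) := by
        rw [star_sub, star_mul, star_mul, hs]; abel
      exact sub_eq_zero.1 ((hB.eq_zero_or_eq_zero (h0 a) fun r => by
        rw [hst, mul_neg, h0, neg_zero]).resolve_right ha)
    have hUc : ∀ u ∈ U, u ∈ NonUnitalSubring.center B := fun u hu =>
      hsp.mem_center_of_double_commutator htor fun a => hcomm u hu _ (hlie u hu a)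
    exact hUc _ (add_mem (hU hx hy) (hU hy hx))

end LowDegree

/-! ### Transfer to the quotients by `*`-prime ideals. -/

section Quotients

variable {A : Type*} [NonUnitalRing A]

/-- Divisibility by 2, unlike absence of 2-torsion, passes to any quotient, even when `P` is not
known to be `Φ`-stable; torsion-freeness is then recovered from semiprimeness. -/
theorem exists_add_self_quotient (hdiv : ∀ a : A, ∃ c, c + c = a) (P : TwoSidedIdeal A)
    (b : P.ringCon.Quotient) : ∃ c, c + c = b := by
  induction b using Quotient.inductionOn' with
  | h b =>
    obtain ⟨d, rfl⟩ := hdiv b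
    exact ⟨(d : P.ringCon.Quotient), rfl⟩

theorem coe_mem_center (P : TwoSidedIdeal A) {z : A} (hz : z ∈ NonUnitalSubring.center A) :
    (z : P.ringCon.Quotient) ∈ NonUnitalSubring.center P.ringCon.Quotient := by
  rw [NonUnitalSubring.mem_center_iff]
  intro g
  induction g using Quotient.inductionOn' with
  | h g => exact congrArg Quotient.mk'' (NonUnitalSubring.mem_center_iff.1 hz g)

variable [StarRing A]

theorem exists_skew_lift (hdiv : ∀ a : A, ∃ c, c + c = a) {P : TwoSidedIdeal A}
    (hP : IsStarPrimeIdeal P) {x : P.ringCon.Quotient}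
    (hx : (quotientStarRing hP.1).star x = -x) :
    ∃ k : A, star k = -k ∧ (k : P.ringCon.Quotient) = x := by
  let _ := quotientStarRing hP.1
  induction x using Quotient.inductionOn' with
  | h a =>
    obtain ⟨c, rfl⟩ := hdiv a
    refine ⟨c - star c, by rw [star_sub, star_star, neg_sub], ?_⟩
    have h1 : ((c + c + star (c + c) : A) : P.ringCon.Quotient) = 0 := by
      change ((c + c : A) : P.ringCon.Quotient) + star ((c + c : A) : P.ringCon.Quotient) = 0
      exact (congrArg (_ + ·) hx).trans (add_neg_cancel _)
    have h2 : ((c + star c : A) : P.ringCon.Quotient) = 0 := by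
      refine hP.isStarPrime_quotient.isSemiprimeRing.eq_zero_of_add_self
        (exists_add_self_quotient hdiv P) ?_
      rw [← h1, star_add, show c + c + (star c + star c) = (c + star c) + (c + star c) by abel]
      rfl
    rw [← add_zero ((c - star c : A) : P.ringCon.Quotient), ← h2]
    change ((c - star c + (c + star c) : A) : P.ringCon.Quotient) = ((c + c : A) : P.ringCon.Quotient)
    rw [show c - star c + (c + star c) = c + c by abel]

/-- Under the degree condition, a central skew element whose cube sends all anticommutators of skew
elements into the centre vanishes. -/
theorem eq_zero_of_cube_mul_mem_center (hA : IsSemiprimeRing A)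
    (hdiv : ∀ a : A, ∃ c, c + c = a) (hD : StarPrimeQuotientsDegreeGTTwo A) {z : A}
    (hz : z ∈ NonUnitalSubring.center A) (hzs : star z = -z)
    (h : ∀ x y : A, star x = -x → star y = -y →
      z * z * z * (x * y + y * x) ∈ NonUnitalSubring.center A) : z = 0 := by
  by_contra hz0
  obtain ⟨P, hP, hzP⟩ := hA.exists_isStarPrimeIdeal_notMem hz0
  let _ := quotientStarRing hP.1
  have hB := hP.isStarPrime_quotient
  have hdivB := exists_add_self_quotient hdiv P
  have hzc := coe_mem_center P hz
  have hzB : (z : P.ringCon.Quotient) ≠ 0 := fun h0 => hzP ((coe_eq_zero_iff P z).1 h0)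
  have hzsB : star (z : P.ringCon.Quotient) = -(z : P.ringCon.Quotient) :=
    congrArg Quotient.mk'' hzs
  have hreg : ∀ a, (z : P.ringCon.Quotient) * a = 0 → a = 0 := fun a =>
    hB.eq_zero_of_central_mul hzc (Or.inr hzsB) hzB
  refine (hD P hP).not_ge (ringDegree_le_two_of_skew hB
    (fun b => hB.isSemiprimeRing.eq_zero_of_add_self hdivB) (fun x y hx hy => ?_) hdivB)
  obtain ⟨k, hk, rfl⟩ := exists_skew_lift hdiv hP hx
  obtain ⟨l, hl, rfl⟩ := exists_skew_lift hdiv hP hy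
  refine mem_center_of_mul (mul_mem (mul_mem hzc hzc) hzc) (fun a ha => ?_)
    (coe_mem_center P (h k l hk hl))
  rw [mul_assoc, mul_assoc] at ha
  exact hreg _ (hreg _ (hreg _ ha))

/-- Under the degree condition, a symmetric element anticommuting with all skew elements
vanishes. -/
theorem eq_zero_of_anticommute_skew (hA : IsSemiprimeRing A)
    (hdiv : ∀ a : A, ∃ c, c + c = a) (hD : StarPrimeQuotientsDegreeGTTwo A) {s : A}
    (hs : star s = s) (h : ∀ x : A, star x = -x → s * x = -(x * s)) : s = 0 := by
  by_contra hs0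
  obtain ⟨P, hP, hsP⟩ := hA.exists_isStarPrimeIdeal_notMem hs0
  let _ := quotientStarRing hP.1
  have hB := hP.isStarPrime_quotient
  have hdivB := exists_add_self_quotient hdiv P
  refine (hD P hP).not_ge (ringDegree_le_two_of_skew hB
    (fun b => hB.isSemiprimeRing.eq_zero_of_add_self hdivB) (fun x y hx hy => ?_) hdivB)
  refine skew_anticommutator_mem_center hB hdivB (s := (s : P.ringCon.Quotient))
    (congrArg Quotient.mk'' hs) (fun h0 => hsP ((coe_eq_zero_iff P s).1 h0))
    (fun x hx => ?_) hx hy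
  obtain ⟨k, hk, rfl⟩ := exists_skew_lift hdiv hP hx
  exact congrArg Quotient.mk'' (h k hk)

end Quotients

/-! ### Derivations mapping skew elements into the centre. -/

section SkewDerivations

variable {Φ A : Type*} [CommRing Φ] [NonUnitalRing A] [Module Φ A]

theorem exists_add_self_of_isUnit_two (h2 : IsUnit (2 : Φ)) (a : A) : ∃ c, c + c = a := by
  obtain ⟨u, hu⟩ := h2
  refine ⟨(↑u⁻¹ : Φ) • a, ?_⟩
  rw [← two_smul Φ, ← hu, smul_smul, Units.mul_inv, one_smul]

variable [IsScalarTower Φ A A] [SMulCommClass Φ A A]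

theorem smul_mem_center (c : Φ) {a : A} (ha : a ∈ NonUnitalSubring.center A) :
    c • a ∈ NonUnitalSubring.center A := by
  rw [NonUnitalSubring.mem_center_iff] at ha ⊢
  intro g
  rw [mul_smul_comm, smul_mul_assoc, ha g]

theorem mem_center_of_three_nsmul (h3 : IsUnit (3 : Φ)) {a : A}
    (h : a + a + a ∈ NonUnitalSubring.center A) : a ∈ NonUnitalSubring.center A := by
  obtain ⟨u, hu⟩ := h3
  have e : a + a + a = (3 : Φ) • a := by
    rw [show (3 : Φ) = 1 + 1 + 1 by norm_num, add_smul, add_smul, one_smul]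
  have := smul_mem_center (↑u⁻¹ : Φ) h
  rwa [e, ← hu, smul_smul, Units.inv_mul, one_smul] at this

variable [Star Φ] [TrivialStar Φ] [StarRing A] [StarModule Φ A]

variable {δ : SDer Φ A}

theorem SDer.map_mul (δ : SDer Φ A) (x y : A) : δ.1 (x * y) = δ.1 x * y + x * δ.1 y :=
  δ.2.1 x y

theorem SDer.star_map_of_skew (δ : SDer Φ A) {x : A} (hx : star x = -x) :
    star (δ.1 x) = -δ.1 x := by
  rw [← δ.2.2, hx, map_neg]

/-- If `δ` maps skew elements into the centre, then `δ(x) x ^ 2` is central for skew `x`. -/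
theorem map_mul_sq_mem_center (h3 : IsUnit (3 : Φ)) (hδ : δ ∈ IKZ Φ A) {x : A}
    (hx : star x = -x) : δ.1 x * (x * x) ∈ NonUnitalSubring.center A := by
  apply mem_center_of_three_nsmul h3
  have h := hδ (x * x * x) (show star (x * x * x) = -(x * x * x) by
    rw [star_mul, star_mul, hx, neg_mul_neg, neg_mul, mul_assoc])
  have hz := mul_comm_of_mem_center (hδ x hx)
  convert h using 1
  rw [SDer.map_mul, SDer.map_mul, ← hz x, ← hz (x * x), add_mul, mul_assoc]

/-- Under the degree condition, `I_{K,Z} = 0`. -/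
theorem IKZ_eq_bot (h2 : IsUnit (2 : Φ)) (h3 : IsUnit (3 : Φ)) (hA : IsSemiprimeRing A)
    (hD : StarPrimeQuotientsDegreeGTTwo A) : IKZ Φ A = ⊥ := by
  rw [eq_bot_iff]
  intro δ hδ
  have hdiv := exists_add_self_of_isUnit_two (A := A) h2
  have htor : ∀ b : A, b + b = 0 → b = 0 := fun b => hA.eq_zero_of_add_self hdiv
  have hc : ∀ {x : A}, star x = -x → δ.1 x ∈ NonUnitalSubring.center A := fun {x} hx => hδ x hx
  have hadd : ∀ {x y : A}, star x = -x → star y = -y → star (x + y) = -(x + y) := by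
    intro x y hx hy
    rw [star_add, hx, hy, neg_add]
  have hsub : ∀ {x y : A}, star x = -x → star y = -y → star (x - y) = -(x - y) := by
    intro x y hx hy
    rw [star_sub, hx, hy]; abel
  have h1 := fun {x : A} (hx : star x = -x) => map_mul_sq_mem_center h3 hδ hx
  have h2' : ∀ {x y : A}, star x = -x → star y = -y →
      δ.1 x * (y * y) + δ.1 y * (x * y + y * x) ∈ NonUnitalSubring.center A := by
    intro x y hx hy
    apply mem_center_of_add_self htor
    -- Adding the values of the cubic form at `x + y` and `x - y` isolates the part of degree 2 in
    -- `y`, doubled.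
    have h := sub_mem (sub_mem (add_mem (h1 (hadd hx hy)) (h1 (hsub hx hy))) (h1 hx)) (h1 hx)
    convert h using 1
    simp only [map_add, map_sub, add_mul, mul_add, sub_mul, mul_sub]
    abel
  have hF : ∀ {x y v : A}, star x = -x → star y = -y → star v = -v →
      δ.1 x * (y * v + v * y) + δ.1 y * (x * v + v * x) + δ.1 v * (x * y + y * x) ∈
        NonUnitalSubring.center A := by
    intro x y v hx hy hv
    have h := sub_mem (sub_mem (h2' hx (hadd hy hv)) (h2' hx hy)) (h2' hx hv)
    convert h using 1
    simp only [map_add, add_mul, mul_add]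
    abel
  have hskew : ∀ x : A, star x = -x → δ.1 x = 0 := by
    intro x hx
    have hz := hc hx
    have hzc := mul_comm_of_mem_center hz
    have hsq : ∀ y, star y = -y →
        δ.1 x * δ.1 x * (x * y + y * x) ∈ NonUnitalSubring.center A := by
      intro y hy
      -- With `z = δ(x)`, the terms `z δ(y) x²` cancel, leaving `z² (x y + y x)`.
      have h := sub_mem (mul_mem hz (h2' hy hx)) (mul_mem (hc hy) (h1 hx))
      convert h using 1
      have e : δ.1 x * (δ.1 y * (x * x)) = δ.1 y * (δ.1 x * (x * x)) := by
        rw [← mul_assoc, hzc, mul_assoc]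
      rw [mul_add (δ.1 x) (δ.1 y * (x * x)), e, add_comm (x * y), mul_assoc]
      abel
    refine eq_zero_of_cube_mul_mem_center hA hdiv hD hz (SDer.star_map_of_skew δ hx)
      fun y v hy hv => ?_
    have hzz := mul_mem hz hz
    -- Multiplying the trilinear relation by `z²` makes the two terms containing `x` in an
    -- anticommutator central; only `z³ (y v + v y)` remains.
    have h := sub_mem (sub_mem (mul_mem hzz (hF hx hy hv)) (mul_mem (hc hy) (hsq v hv)))
      (mul_mem (hc hv) (hsq y hy))
    convert h using 1
    have e : ∀ a b, δ.1 x * δ.1 x * (a * b) = a * (δ.1 x * δ.1 x * b) := fun a b => by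
      rw [← mul_assoc, mul_comm_of_mem_center hzz, mul_assoc]
    rw [mul_add (δ.1 x * δ.1 x), mul_add (δ.1 x * δ.1 x), e (δ.1 y), e (δ.1 v),
      mul_assoc (δ.1 x * δ.1 x)]
    abel
  have hsymm : ∀ h : A, star h = h → δ.1 h = 0 := by
    intro h hh
    refine eq_zero_of_anticommute_skew hA hdiv hD (by rw [← δ.2.2, hh]) fun x hx => ?_
    have e := hskew (h * x + x * h) (by
      rw [star_add, star_mul, star_mul, hh, hx, neg_mul, mul_neg]; abel)
    rw [map_add, SDer.map_mul, SDer.map_mul, hskew x hx, mul_zero, add_zero, zero_mul,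
      zero_add] at e
    exact eq_neg_of_add_eq_zero_left e
  rw [LieSubmodule.mem_bot]
  apply Subtype.ext
  ext a
  obtain ⟨h, k, hh, hk, rfl⟩ := exists_symm_add_skew hdiv a
  rw [map_add, hskew k hk, hsymm h hh, add_zero]
  rfl

/-- With `z = [k, x]`, bracketing the central element `z x²` with `k` gives `2 z² x = 0`; bracketing
`z² x = 0` with `k` gives `z³ = 0`. -/
theorem ad_eq_zero_of_adSkew_mem_IKZ (h2 : IsUnit (2 : Φ)) (h3 : IsUnit (3 : Φ))
    (hA : IsSemiprimeRing A) {k : skew Φ A} (hk : adSkew Φ A k ∈ IKZ Φ A) :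
    LieAlgebra.ad Φ (skew Φ A) k = 0 := by
  have htor : ∀ b : A, b + b = 0 → b = 0 := fun b =>
    hA.eq_zero_of_add_self (exists_add_self_of_isUnit_two h2)
  ext x
  obtain ⟨x, hx⟩ := x
  obtain ⟨k, hks⟩ := k
  change k * x - x * k = 0
  have hz : k * x - x * k ∈ NonUnitalSubring.center A := hk x hx
  have hzx : (k * x - x * k) * (x * x) ∈ NonUnitalSubring.center A :=
    map_mul_sq_mem_center h3 hk hx
  obtain ⟨z, hz_def⟩ : ∃ z, z = k * x - x * k := ⟨_, rfl⟩
  rw [← hz_def] at hz hzx ⊢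
  have hzc := mul_comm_of_mem_center hz
  have hkx : k * x = z + x * k := by rw [hz_def]; abel
  have e1 : z * z * x = 0 := by
    apply htor
    have e := mul_comm_of_mem_center hzx k
    have e' : k * (z * (x * x)) = z * z * x + z * z * x + z * (x * x) * k := by
      rw [← mul_assoc, ← hzc, mul_assoc, ← mul_assoc k, hkx, add_mul, mul_assoc x k, hkx, mul_add x,
        ← hzc x]
      simp only [mul_add, mul_assoc]
      abel
    rw [e'] at e
    exact (right_eq_add.1 e)
  refine hA.eq_zero_of_central_cube hz ?_
  have e2 : z * z * (k * x) = 0 := by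
    rw [← mul_assoc, mul_comm_of_mem_center (mul_mem hz hz) k, mul_assoc, e1, mul_zero]
  rwa [hkx, mul_add, ← mul_assoc _ x k, e1, zero_mul, add_zero] at e2

/-- This makes the map on `Inn(K)` well defined: the difference of the two derivations kills `K`,
although it need not vanish on `A`. -/
theorem adSkew_eq_of_ad_eq {k l : skew Φ A}
    (h : LieAlgebra.ad Φ (skew Φ A) k = LieAlgebra.ad Φ (skew Φ A) l) :
    (LieSubmodule.Quotient.mk (adSkew Φ A k) : SDer Φ A ⧸ IKZ Φ A) =
      LieSubmodule.Quotient.mk (adSkew Φ A l) := by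
  refine (Submodule.Quotient.eq _).2 fun x hx => ?_
  have e : k.1 * x - x * k.1 = l.1 * x - x * l.1 :=
    congrArg Subtype.val (LinearMap.congr_fun h ⟨x, hx⟩)
  change k.1 * x - x * k.1 - (l.1 * x - x * l.1) ∈ _
  rw [e, sub_self]
  exact zero_mem _

/-- `⁅δ, ad k⁆ = ad (δ k)`. -/
theorem lie_adSkew (δ : SDer Φ A) (k : skew Φ A) :
    ⁅δ, adSkew Φ A k⁆ = adSkew Φ A ⟨δ.1 k.1, SDer.star_map_of_skew δ k.2⟩ := by
  apply Subtype.ext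
  ext x
  change δ.1 (k.1 * x - x * k.1) - (k.1 * δ.1 x - δ.1 x * k.1) = δ.1 k.1 * x - x * δ.1 k.1
  rw [map_sub, SDer.map_mul, SDer.map_mul]
  abel

/-- A semiprime ring without `2`-torsion has no non-zero `*`-ideal of central skew elements. -/
theorem centerKHasNoStarIdeal (h2 : IsUnit (2 : Φ)) (hA : IsSemiprimeRing A) :
    CenterKHasNoStarIdeal Φ A := by
  intro I _ hI
  have hskew : ∀ x ∈ I, star x = -x := fun x hx => by
    obtain ⟨k, -, rfl⟩ := hI x hx
    exact k.2
  have hcomm : ∀ x ∈ I, ∀ y ∈ I, x * y = y * x := fun x hx y hy => by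
    obtain ⟨k, hk, rfl⟩ := hI x hx
    have h : y * k.1 - k.1 * y = 0 := congrArg Subtype.val
      ((LieModule.mem_maxTrivSubmodule Φ _ _ k).1 hk ⟨y, hskew y hy⟩)
    exact (sub_eq_zero.1 h).symm
  -- The product `x y` is skew, yet `(x y)* = y* x* = y x = x y`; hence `2 x y = 0`.
  refine hA I fun x hx y hy => hA.eq_zero_of_add_self (exists_add_self_of_isUnit_two h2) ?_
  have h := hskew (x * y) (I.mul_mem_left _ _ hy)
  rw [star_mul, hskew x hx, hskew y hy, neg_mul_neg, hcomm y hy x hx] at h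
  exact eq_neg_iff_add_eq_zero.1 h

end SkewDerivations

/-! ### The image of `Inn(K)` in the quotient and its essentiality. -/

section InnerDerivations

variable (Φ A : Type*) [CommRing Φ] [NonUnitalRing A] [Module Φ A] [IsScalarTower Φ A A]
  [SMulCommClass Φ A A] [Star Φ] [TrivialStar Φ] [StarRing A] [StarModule Φ A]

/-- The Lie homomorphism `Inn(K) → SDer(A) / I_{K,Z}` sending `⁅k, ·⁆` to the class of `ad k`. -/
noncomputable def innToQuotient : InnK Φ A →ₗ⁅Φ⁆ (SDer Φ A ⧸ IKZ Φ A) :=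
  have key : ∀ (f : InnK Φ A) (k : skew Φ A), LieAlgebra.ad Φ (skew Φ A) k = f.1 →
      (LieSubmodule.Quotient.mk (adSkew Φ A ((LieHom.mem_range _ _).1 f.2).choose) :
        SDer Φ A ⧸ IKZ Φ A) = LieSubmodule.Quotient.mk (adSkew Φ A k) := fun f k h =>
    adSkew_eq_of_ad_eq (((LieHom.mem_range _ _).1 f.2).choose_spec.trans h.symm)
  { toFun := fun f => LieSubmodule.Quotient.mk
      (adSkew Φ A ((LieHom.mem_range _ _).1 f.2).choose)
    map_add' := by
      rintro ⟨_, k, rfl⟩ ⟨_, l, rfl⟩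
      rw [key ⟨_, k, rfl⟩ k rfl, key ⟨_, l, rfl⟩ l rfl, key _ (k + l) (map_add _ k l), map_add]
      rfl
    map_smul' := by
      rintro c ⟨_, k, rfl⟩
      rw [key ⟨_, k, rfl⟩ k rfl, key _ (c • k) (map_smul _ c k), map_smul]
      rfl
    map_lie' := by
      rintro ⟨_, k, rfl⟩ ⟨_, l, rfl⟩
      change LieSubmodule.Quotient.mk _ = ⁅LieSubmodule.Quotient.mk _, LieSubmodule.Quotient.mk _⁆
      rw [key ⟨_, k, rfl⟩ k rfl, key ⟨_, l, rfl⟩ l rfl, key _ ⁅k, l⁆ (LieHom.map_lie _ k l),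
        LieHom.map_lie, LieSubmodule.Quotient.mk_bracket] }

theorem innToQuotient_ad (k : skew Φ A) :
    innToQuotient Φ A ⟨LieAlgebra.ad Φ (skew Φ A) k, LieHom.mem_range_self _ k⟩ =
      LieSubmodule.Quotient.mk (adSkew Φ A k) :=
  adSkew_eq_of_ad_eq ((LieHom.mem_range _ _).1 (LieHom.mem_range_self _ k)).choose_spec

variable {Φ A}

theorem innToQuotient_injective (h2 : IsUnit (2 : Φ)) (h3 : IsUnit (3 : Φ))
    (hA : IsSemiprimeRing A) : Function.Injective (innToQuotient Φ A) := by
  rw [injective_iff_map_eq_zero]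
  rintro ⟨_, k, rfl⟩ h
  have h' := (innToQuotient_ad Φ A k).symm.trans h
  exact Subtype.ext (ad_eq_zero_of_adSkew_mem_IKZ h2 h3 hA
    (LieSubmodule.Quotient.mk_eq_zero'.1 h'))

variable (Φ A) in
/-- The image of `Inn(K)`, as an ideal of `SDer(A) / I_{K,Z}`. -/
noncomputable def innIdeal : LieIdeal Φ (SDer Φ A ⧸ IKZ Φ A) where
  toSubmodule := LinearMap.range (innToQuotient Φ A : InnK Φ A →ₗ[Φ] (SDer Φ A ⧸ IKZ Φ A))
  lie_mem := by
    rintro x _ ⟨⟨_, k, rfl⟩, rfl⟩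
    obtain ⟨δ, rfl⟩ := LieSubmodule.Quotient.surjective_mk' _ x
    refine ⟨⟨_, LieHom.mem_range_self _ ⟨δ.1 k.1, SDer.star_map_of_skew δ k.2⟩⟩, ?_⟩
    refine (innToQuotient_ad Φ A _).trans ?_
    rw [← lie_adSkew, LieSubmodule.Quotient.mk_bracket]
    exact congrArg (Bracket.bracket _) (innToQuotient_ad Φ A k).symm

theorem mk_adSkew_mem_innIdeal (k : skew Φ A) :
    LieSubmodule.Quotient.mk (adSkew Φ A k) ∈ innIdeal Φ A :=
  ⟨_, innToQuotient_ad Φ A k⟩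

theorem innIdeal_isEssential (hIKZ : IKZ Φ A = ⊥) : IsEssentialIdeal (innIdeal Φ A) := by
  intro I hI h
  refine hI ((LieSubmodule.eq_bot_iff _).2 fun x hx => ?_)
  obtain ⟨δ, rfl⟩ := LieSubmodule.Quotient.surjective_mk' _ x
  refine LieSubmodule.Quotient.mk_eq_zero'.2 fun k hk => ?_
  -- The bracket lies in `I`, and in the image because it equals `ad (δ k)`. A trivial intersection
  -- thus gives `ad (δ k) ∈ I_{K,Z} = 0`, so `δ k` is central.
  have hmem : (LieSubmodule.Quotient.mk ⁅δ, adSkew Φ A ⟨k, hk⟩⁆ : SDer Φ A ⧸ IKZ Φ A) ∈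
      innIdeal Φ A ⊓ I := by
    refine ⟨?_, ?_⟩
    · rw [lie_adSkew]
      exact mk_adSkew_mem_innIdeal _
    · rw [LieSubmodule.Quotient.mk_bracket]
      exact lie_mem_left Φ _ I _ _ hx
  rw [h, LieSubmodule.mem_bot, LieSubmodule.Quotient.mk_eq_zero', hIKZ, LieSubmodule.mem_bot,
    lie_adSkew] at hmem
  rw [NonUnitalSubring.mem_center_iff]
  intro g
  have e : δ.1 k * g - g * δ.1 k = 0 := LinearMap.congr_fun (congrArg Subtype.val hmem) g
  exact (sub_eq_zero.1 e).symm

end InnerDerivations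

end StarDer
theorem mainTheorem8 {Φ A : Type*} [CommRing Φ] [Star Φ] [TrivialStar Φ]
    [NonUnitalRing A] [StarRing A] [Module Φ A] [IsScalarTower Φ A A] [SMulCommClass Φ A A]
    [StarModule Φ A]
    (h2 : IsUnit (2 : Φ)) (h3 : IsUnit (3 : Φ))
    (hsemiprime : StarDer.IsSemiprimeRing A)
    (hnoncomm : ∃ x y : A, x * y ≠ y * x) :
    (∃ φ : StarDer.InnK Φ A →ₗ⁅Φ⁆ (StarDer.SDer Φ A ⧸ StarDer.IKZ Φ A),
      (∀ k : StarDer.skew Φ A,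
        φ ⟨LieAlgebra.ad Φ (StarDer.skew Φ A) k, LieHom.mem_range_self _ k⟩ =
          LieSubmodule.Quotient.mk (StarDer.adSkew Φ A k)) ∧
      Function.Injective φ ∧
      ∃ J : LieIdeal Φ (StarDer.SDer Φ A ⧸ StarDer.IKZ Φ A),
        (J : Set (StarDer.SDer Φ A ⧸ StarDer.IKZ Φ A)) = Set.range φ ∧
        (StarDer.StarPrimeQuotientsDegreeGTTwo A → StarDer.IsEssentialIdeal J)) ∧
    (StarDer.StarPrimeQuotientsDegreeGTTwo A →
      (∀ k : StarDer.skew Φ A, StarDer.adSkew Φ A k ∈ StarDer.IKZ Φ A →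
        StarDer.adSkew Φ A k = 0) ∧
      (StarDer.CenterKHasNoStarIdeal Φ A → StarDer.IKZ Φ A = ⊥) ∧
      (StarDer.IsStarPrime A →
        StarDer.CenterKHasNoStarIdeal Φ A ∧ StarDer.IKZ Φ A = ⊥)) := by
  open StarDer in
  refine ⟨⟨innToQuotient Φ A, innToQuotient_ad Φ A, innToQuotient_injective h2 h3 hsemiprime,
    innIdeal Φ A, rfl, fun hD => innIdeal_isEssential (IKZ_eq_bot h2 h3 hsemiprime hD)⟩,
    fun hD => ?_⟩
  have hbot := StarDer.IKZ_eq_bot h2 h3 hsemiprime hD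
  exact ⟨fun k hk => (LieSubmodule.mem_bot _).1 (hbot ▸ hk), fun _ => hbot,
    fun _ => ⟨StarDer.centerKHasNoStarIdeal h2 hsemiprime, hbot⟩⟩
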